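/- All registers are finite-dimensional and $\log=\log_2$. For states $\rho,\sigma$ let $D_H^{\varepsilon}(\rho\|\sigma)=\sup\{\log\frac{1}{\mathrm{Tr}(\Lambda\sigma)} : 0\preceq\Lambda\preceq I,\ \mathrm{Tr}(\Lambda\rho)\ge 1-\varepsilon\}\in(-\infty,+\infty]$. Fix a quantum channel (completely positive trace-preserving map) $\mathcal N_{AB\to C}$. For real $R_1,R_2$ such that $2^{R_1},2^{R_2}$ are positive integers, a code for $\mathcal N$ consists of encoding channels $\mathcal E_1:M_1\to A$, $\mathcal E_2:M_2\to B$ and a decoding channel $\mathcal D:C\to M_1'M_2'$, where $M_1,M_2$ are independent classical messages, uniformly distributed over $2^{R_1}$ and $2^{R_2}$ values respectively, and $M_i'\equiv M_i$. It is an $(R_1,R_2,\varepsilon_1,\varepsilon_2)$-code if $\Pr(M_1'\ne M_1)\le\varepsilon_1$ and $\Pr(M_2'\ne M_2)\le\varepsilon_2$. For classical-quantum states $\psi_{UA},\psi_{VB}$ (with $U,V$ classical) put $\rho_{CUV}=\mathcal N_{AB\to C}(\psi_{UA}\otimes\psi_{VB})$. Let $\varepsilon_1,\varepsilon_2\in(0,1)$.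 (Converse) For every $(R_1,R_2,\varepsilon_1,\varepsilon_2)$-code for $\mathcal N$ there exist classical registers $U,V$ and classical-quantum states $\psi_{UA},\psi_{VB}$ with uniform marginals $\psi_U=\frac{I_U}{|U|}$, $\psi_V=\frac{I_V}{|V|}$ such that $$R_1\le\min_{\sigma_C}D_H^{\varepsilon_1}(\rho_{CU}\|\sigma_C\otimes\rho_U),\qquad R_2\le\min_{\tau_C}D_H^{\varepsilon_2}(\rho_{CV}\|\tau_C\otimes\rho_V),$$ the minima being over all states of $C$, and moreover, if $\varepsilon_1+\varepsilon_2<1$, then $|U||V|\le|C|^{1/(1-\varepsilon_1-\varepsilon_2)}$, except that in the case $|C|=2$, $2^{R_1+R_2}=3$ (which does not occur when $R_1,R_2$ are integers) one may instead have $|U||V|=3$. (Achievability) For all classical-quantum states $\psi_{UA},\psi_{VB}$, every $\delta\in(0,1)$ and all $R_1,R_2$ such that $2^{R_1},2^{R_2}$ are positive integers, if $$R_1\le D_H^{\varepsilon_1}(\rho_{CU}\|\rho_C\otimes\rho_U)-\log\tfrac1\delta,\qquad R_2\le D_H^{\varepsilon_2}(\rho_{CV}\|\rho_C\otimes\rho_V)-\log\tfrac1\delta,$$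 then there is an $(R_1,R_2,4(\varepsilon_1+\varepsilon_2+2\delta),4(\varepsilon_1+\varepsilon_2+2\delta))$-code for $\mathcal N$ which in fact satisfies $$\Pr\big((M_1',M_2')\ne(M_1,M_2)\big)\le 4(\varepsilon_1+\varepsilon_2+2\delta).$$ -/

import Mathlib

open scoped Kronecker ComplexOrder

namespace QMAC

noncomputable section

/-! A quantum register is given by a finite index set of its computational basis; operators on the
register are complex matrices over that set, and registers are composed by taking products of
index sets. -/

/-- A quantum state (density matrix): positive semidefinite of trace one. -/
def IsState {X : Type*} [Fintype X] (ρ : Matrix X X ℂ) : Prop :=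
  ρ.PosSemidef ∧ ρ.trace = 1

/-- The partial trace over the second register. -/
def traceSnd {X Y : Type*} [Fintype Y] (ρ : Matrix (X × Y) (X × Y) ℂ) : Matrix X X ℂ :=
  Matrix.of fun x x' => ∑ y, ρ (x, y) (x', y)

/-- The partial trace over the first register. -/
def traceFst {X Y : Type*} [Fintype X] (ρ : Matrix (X × Y) (X × Y) ℂ) : Matrix Y Y ℂ :=
  Matrix.of fun y y' => ∑ x, ρ (x, y) (x, y')

/-- The action of `N ⊗ id` on a matrix over `X × S`, where `N` acts on the register `X` and `S` is
an arbitrary reference register. -/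
def applyFst {X Y S : Type*} (N : Matrix X X ℂ →ₗ[ℂ] Matrix Y Y ℂ)
    (M : Matrix (X × S) (X × S) ℂ) : Matrix (Y × S) (Y × S) ℂ :=
  Matrix.of fun p q => N (Matrix.of fun x x' => M (x, p.2) (x', q.2)) p.1 q.1

/-- A quantum channel: a completely positive and trace preserving linear map. -/
structure IsChannel {X Y : Type*} [Fintype X] [Fintype Y]
    (N : Matrix X X ℂ →ₗ[ℂ] Matrix Y Y ℂ) : Prop where
  completelyPositive : ∀ (n : ℕ) (M : Matrix (X × Fin n) (X × Fin n) ℂ),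
    M.PosSemidef → (applyFst N M).PosSemidef
  tracePreserving : ∀ M : Matrix X X ℂ, (N M).trace = M.trace

/-- A classical-quantum state on `U × X`, with classical register `U`: a state that is block
diagonal with respect to the computational basis of `U`. -/
def IsCQState {U X : Type*} [Fintype U] [Fintype X] (ψ : Matrix (U × X) (U × X) ℂ) : Prop :=
  IsState ψ ∧ ∀ u u' x x', u ≠ u' → ψ (u, x) (u', x') = 0

/-- `log₂ (1 / t)` for `t ≥ 0`, with `log₂ (1 / 0) = +∞`. -/
def logInv (t : ℝ) : EReal :=
  if t = 0 then ⊤ else ((Real.logb 2 (1 / t) : ℝ) : EReal)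

/-- The smooth quantum hypothesis testing divergence `D_H^ε(ρ ‖ σ)`: the supremum of
`log₂ (1 / Tr(Λσ))` over the tests `0 ≤ Λ ≤ 1` with `Tr(Λρ) ≥ 1 - ε`. -/
def hypoDiv {X : Type*} [Fintype X] [DecidableEq X] (ε : ℝ) (ρ σ : Matrix X X ℂ) : EReal :=
  ⨆ Λ ∈ {Λ : Matrix X X ℂ | Λ.PosSemidef ∧ (1 - Λ).PosSemidef ∧ 1 - ε ≤ (Λ * ρ).trace.re},
    logInv (Λ * σ).trace.re

/-- The state `ρ_{CUV} = N_{AB → C}(ψ_{UA} ⊗ φ_{VB})`. -/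
def macOutput {A B C U V : Type*} (N : Matrix (A × B) (A × B) ℂ →ₗ[ℂ] Matrix C C ℂ)
    (ψ : Matrix (U × A) (U × A) ℂ) (φ : Matrix (V × B) (V × B) ℂ) :
    Matrix (C × (U × V)) (C × (U × V)) ℂ :=
  applyFst N ((ψ ⊗ₖ φ).submatrix
    (fun i : (A × B) × (U × V) => ((i.2.1, i.1.1), (i.2.2, i.1.2)))
    (fun i : (A × B) × (U × V) => ((i.2.1, i.1.1), (i.2.2, i.1.2))))

/-- The marginal `ρ_{CU}` of `ρ_{CUV}`. -/
def margCU {C U V : Type*} [Fintype V] (ρ : Matrix (C × (U × V)) (C × (U × V)) ℂ) :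
    Matrix (C × U) (C × U) ℂ :=
  Matrix.of fun p q => ∑ v, ρ (p.1, (p.2, v)) (q.1, (q.2, v))

/-- The marginal `ρ_{CV}` of `ρ_{CUV}`. -/
def margCV {C U V : Type*} [Fintype U] (ρ : Matrix (C × (U × V)) (C × (U × V)) ℂ) :
    Matrix (C × V) (C × V) ℂ :=
  Matrix.of fun p q => ∑ u, ρ (p.1, (u, p.2)) (q.1, (u, q.2))

/-- Encoders `M₁ → A`, `M₂ → B` and a decoder `C → M₁' M₂'` for message sets with `K₁` and `K₂`
elements. -/
structure MACCode (A B C : Type*) [Fintype A] [Fintype B] [Fintype C] (K₁ K₂ : ℕ) where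
  enc₁ : Matrix (Fin K₁) (Fin K₁) ℂ →ₗ[ℂ] Matrix A A ℂ
  enc₂ : Matrix (Fin K₂) (Fin K₂) ℂ →ₗ[ℂ] Matrix B B ℂ
  dec : Matrix C C ℂ →ₗ[ℂ] Matrix (Fin K₁ × Fin K₂) (Fin K₁ × Fin K₂) ℂ
  enc₁_channel : IsChannel enc₁
  enc₂_channel : IsChannel enc₂
  dec_channel : IsChannel dec

namespace MACCode

variable {A B C : Type*} [Fintype A] [Fintype B] [Fintype C] {K₁ K₂ : ℕ}

/-- The probability that the decoder outputs the pair `m'` when the pair `m` is sent over `N`. -/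
def prob (c : MACCode A B C K₁ K₂) (N : Matrix (A × B) (A × B) ℂ →ₗ[ℂ] Matrix C C ℂ)
    (m m' : Fin K₁ × Fin K₂) : ℝ :=
  (c.dec (N (c.enc₁ (Matrix.single m.1 m.1 1) ⊗ₖ c.enc₂ (Matrix.single m.2 m.2 1))) m' m').re

/-- `Pr(M₁' ≠ M₁)` for independent and uniformly distributed messages. -/
def err₁ (c : MACCode A B C K₁ K₂) (N : Matrix (A × B) (A × B) ℂ →ₗ[ℂ] Matrix C C ℂ) : ℝ :=
  (∑ m : Fin K₁ × Fin K₂, ∑ m' : Fin K₁ × Fin K₂,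
    if m'.1 ≠ m.1 then c.prob N m m' else 0) / ((K₁ : ℝ) * (K₂ : ℝ))

/-- `Pr(M₂' ≠ M₂)` for independent and uniformly distributed messages. -/
def err₂ (c : MACCode A B C K₁ K₂) (N : Matrix (A × B) (A × B) ℂ →ₗ[ℂ] Matrix C C ℂ) : ℝ :=
  (∑ m : Fin K₁ × Fin K₂, ∑ m' : Fin K₁ × Fin K₂,
    if m'.2 ≠ m.2 then c.prob N m m' else 0) / ((K₁ : ℝ) * (K₂ : ℝ))

/-- `Pr((M₁', M₂') ≠ (M₁, M₂))` for independent and uniformly distributed messages. -/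
def errJoint (c : MACCode A B C K₁ K₂) (N : Matrix (A × B) (A × B) ℂ →ₗ[ℂ] Matrix C C ℂ) : ℝ :=
  (∑ m : Fin K₁ × Fin K₂, ∑ m' : Fin K₁ × Fin K₂,
    if m' ≠ m then c.prob N m m' else 0) / ((K₁ : ℝ) * (K₂ : ℝ))

/-- `c` is an `(R₁, R₂, ε₁, ε₂)`-code for the multiple-access channel `N`. -/
def IsCode (c : MACCode A B C K₁ K₂) (N : Matrix (A × B) (A × B) ℂ →ₗ[ℂ] Matrix C C ℂ)
    (R₁ R₂ ε₁ ε₂ : ℝ) : Prop :=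
  (K₁ : ℝ) = 2 ^ R₁ ∧ (K₂ : ℝ) = 2 ^ R₂ ∧ c.err₁ N ≤ ε₁ ∧ c.err₂ N ≤ ε₂

end MACCode

end

end QMAC

/-! Achievability combines random coding with sequential decoding. A lower bound on D_H^ε₁ yields
tests Λ_u on C that accept their own output with average probability at least 1 - ε₁, while K₁ - 1
times their acceptance probability on an independent codeword is at most δ; likewise Γ_v for the
second sender. Each test averages over the other sender, so no simultaneous test for (U, V) is
needed. The receiver tries the codewords of sender one until a test accepts, then those of sender
two on the disturbed state.

The disturbance is controlled by a quantum union bound: if T is a product of square roots of effects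
and E the sum of their complements, then 1 - T†T ≤ 4E (`UnionBound.step`, `UnionBound.le`). Both
rounds form a single product, so the factor 4 enters once. Over random codebooks the expectation of
E in the transmitted state is at most (ε₁ + δ) + (ε₂ + δ) (`expected_cost_le`), and some pair of
codebooks does as well as the average.

For the converse with |C| ≥ 2, take U = M₁ and V = M₂. The decoder pulled back to C is a measurement
Ω, and its marginals are tests that sum to 1. Hence against any σ they accept with average
probability exactly 1/K₁ or 1/K₂, and on the true outputs with the success probability of the code.
Moreover Tr(Ω_m ρ_m) ≤ Tr Ω_m, so summing over m gives K₁K₂(1 - ε₁ - ε₂) ≤ |C|; the behaviour of log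
x / x turns this into the power bound (`natCast_le_rpow_or`). If |C| = 1, one-valued registers
suffice. -/

namespace QMAC

noncomputable section

open Matrix Finset

/-! ### Positive operators: square roots, traces, quadratic forms -/

section Operators

variable {X : Type*} [Fintype X] [DecidableEq X]

/-- Square roots of effects: `S * S = Λ` with `Λ ≤ S ≤ 1`. -/
theorem exists_sqrt {Λ : Matrix X X ℂ} (h0 : Λ.PosSemidef) :
    ∃ S : Matrix X X ℂ, Sᴴ = S ∧ S * S = Λ ∧
      ((1 - Λ).PosSemidef → (1 - S).PosSemidef ∧ (S - Λ).PosSemidef) := by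
  set U : Matrix X X ℂ := (h0.1.eigenvectorUnitary : Matrix X X ℂ) with hU
  set l : X → ℝ := h0.1.eigenvalues with hl
  have hUU : U * Uᴴ = 1 := Unitary.coe_mul_star_self h0.1.eigenvectorUnitary
  have hUU' : Uᴴ * U = 1 := Unitary.coe_star_mul_self h0.1.eigenvectorUnitary
  have hl0 : ∀ i, 0 ≤ l i := h0.eigenvalues_nonneg
  have hspec : Λ = U * diagonal (fun i => (l i : ℂ)) * Uᴴ := by
    conv_lhs => rw [h0.1.spectral_theorem, Unitary.conjStarAlgAut_apply]
    rfl
  have hone : (1 : Matrix X X ℂ) = U * diagonal (fun _ => (1 : ℂ)) * Uᴴ := by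
    rw [diagonal_one, mul_one, hUU]
  refine ⟨U * diagonal (fun i => ((√(l i) : ℝ) : ℂ)) * Uᴴ, ?_, ?_, fun h1 => ?_⟩
  · simp only [conjTranspose_mul, conjTranspose_conjTranspose, diagonal_conjTranspose, mul_assoc]
    congr 3
    ext i
    simp
  · calc _ = U * (diagonal (fun i => ((√(l i) : ℝ) : ℂ)) * (Uᴴ * U) *
          diagonal (fun i => ((√(l i) : ℝ) : ℂ))) * Uᴴ := by simp only [mul_assoc]
      _ = Λ := by
        rw [hUU', mul_one, diagonal_mul_diagonal, hspec]
        congr 3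
        ext i
        rw [← Complex.ofReal_mul, Real.mul_self_sqrt (hl0 i)]
  · have hl1 : ∀ i, l i ≤ 1 := by
      have h2 := h1.conjTranspose_mul_mul_same U
      have h3 : Uᴴ * (1 - Λ) * U = diagonal (fun i => 1 - (l i : ℂ)) := by
        rw [hspec, mul_sub, sub_mul, mul_one, hUU']
        calc _ = 1 - (Uᴴ * U) * diagonal (fun i => (l i : ℂ)) * (Uᴴ * U) := by
              simp only [mul_assoc]
          _ = _ := by rw [hUU', one_mul, mul_one, ← diagonal_one, diagonal_sub]
      rw [h3, posSemidef_diagonal_iff] at h2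
      intro i
      have := h2 i
      rw [sub_nonneg] at this
      exact_mod_cast this
    have key : ∀ f : X → ℝ, (∀ i, 0 ≤ f i) →
        (U * diagonal (fun i => (f i : ℂ)) * Uᴴ).PosSemidef := fun f hf =>
      (PosSemidef.diagonal (fun i => by simpa using hf i)).mul_mul_conjTranspose_same U
    constructor
    · rw [hone, ← sub_mul, ← mul_sub, diagonal_sub]
      have := key (fun i => 1 - √(l i)) (fun i => by
        simpa using Real.sqrt_le_one.mpr (hl1 i))
      simpa using this
    · rw [hspec, ← sub_mul, ← mul_sub, diagonal_sub]
      have := key (fun i => √(l i) - l i) (fun i => by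
        have := Real.sqrt_nonneg (l i)
        have h4 := Real.sqrt_le_one.mpr (hl1 i)
        have h5 := Real.mul_self_sqrt (hl0 i)
        nlinarith)
      simpa using this

theorem posSemidef_exists_conjTranspose_mul {A : Matrix X X ℂ} (h : A.PosSemidef) :
    ∃ B : Matrix X X ℂ, A = Bᴴ * B := by
  obtain ⟨S, h1, h2, -⟩ := exists_sqrt h
  exact ⟨S, by rw [h1, h2]⟩

theorem trace_mul_nonneg {A B : Matrix X X ℂ} (hA : A.PosSemidef) (hB : B.PosSemidef) :
    0 ≤ (A * B).trace := by
  obtain ⟨S, rfl⟩ := posSemidef_exists_conjTranspose_mul hA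
  rw [mul_assoc, trace_mul_comm, mul_assoc, ← mul_assoc]
  exact (hB.mul_mul_conjTranspose_same S).trace_nonneg

theorem re_trace_mul_nonneg {A B : Matrix X X ℂ} (hA : A.PosSemidef) (hB : B.PosSemidef) :
    0 ≤ (A * B).trace.re :=
  (Complex.nonneg_iff.mp (trace_mul_nonneg hA hB)).1

/-- A positive semidefinite matrix is bounded by its trace. -/
theorem posSemidef_trace_smul_one_sub {A : Matrix X X ℂ} (h : A.PosSemidef) :
    (A.trace • (1 : Matrix X X ℂ) - A).PosSemidef := by
  set U : Matrix X X ℂ := (h.1.eigenvectorUnitary : Matrix X X ℂ) with hU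
  have hUU : U * Uᴴ = 1 := Unitary.coe_mul_star_self h.1.eigenvectorUnitary
  have hspec : A = U * diagonal (fun i => (h.1.eigenvalues i : ℂ)) * Uᴴ := by
    conv_lhs => rw [h.1.spectral_theorem, Unitary.conjStarAlgAut_apply]
    rfl
  have hone : A.trace • (1 : Matrix X X ℂ) = U * diagonal (fun _ => A.trace) * Uᴴ := by
    rw [← smul_one_eq_diagonal, Matrix.mul_smul, mul_one, Matrix.smul_mul, hUU]
  rw [hone]
  nth_rewrite 2 [hspec]
  rw [← sub_mul, ← mul_sub, diagonal_sub]
  refine (PosSemidef.diagonal fun i => ?_).mul_mul_conjTranspose_same U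
  rw [h.1.trace_eq_sum_eigenvalues]
  simp only [Pi.zero_apply, sub_nonneg]
  rw [← RCLike.ofReal_sum]
  exact RCLike.ofReal_le_ofReal.mpr (Finset.single_le_sum (f := h.1.eigenvalues)
    (fun j _ => h.eigenvalues_nonneg j) (Finset.mem_univ i))

/-- Positivity of the quadratic form already implies hermiticity over `ℂ`. -/
theorem posSemidef_of_dotProduct {A : Matrix X X ℂ}
    (h : ∀ x : X → ℂ, 0 ≤ star x ⬝ᵥ (A *ᵥ x)) : A.PosSemidef := by
  refine PosSemidef.of_dotProduct_mulVec_nonneg ?_ h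
  rw [← isSymmetric_toEuclideanLin_iff, LinearMap.isSymmetric_iff_inner_map_self_real]
  intro v
  have h1 := h v.ofLp
  rw [RCLike.conj_eq_iff_im]
  have h2 : inner ℂ (toEuclideanLin A v) v = star (star v.ofLp ⬝ᵥ (A *ᵥ v.ofLp)) := by
    rw [← inner_conj_symm, EuclideanSpace.inner_eq_star_dotProduct]
    simp [dotProduct_comm, toLpLin_apply]
  rw [h2]
  have := (Complex.nonneg_iff.mp h1).2
  simp [← this]

end Operators

/-! ### The quantum union bound and sequential measurements -/

section Sequential

variable {X : Type*} [Fintype X] [DecidableEq X]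

/-- The invariant behind the quantum union bound: `T` is a product of square roots of effects, and
`E` is the sum of the complements of these effects. -/
def UnionBound (E T : Matrix X X ℂ) : Prop :=
  (4 • E + (1 - Tᴴ * T) - 2 • (2 • (1 : Matrix X X ℂ) - T - Tᴴ)).PosSemidef

theorem unionBound_zero_one : UnionBound (0 : Matrix X X ℂ) 1 := by
  have : (4 • (0 : Matrix X X ℂ) + (1 - 1ᴴ * 1) - 2 • (2 • (1 : Matrix X X ℂ) - 1 - 1ᴴ)) = 0 := by
    rw [conjTranspose_one]; noncomm_ring
  rw [UnionBound, this]
  exact PosSemidef.zero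

/-- Accounts for the tests after the accepting one, which are counted in E but never performed. -/
theorem UnionBound.mono {E T P : Matrix X X ℂ} (h : UnionBound E T) (hP : P.PosSemidef) :
    UnionBound (E + P) T := by
  have h4 : (4 • P).PosSemidef := by
    have : 4 • P = P + P + P + P := by abel
    rw [this]
    exact ((hP.add hP).add hP).add hP
  have := PosSemidef.add h h4
  rw [UnionBound]
  convert this using 1
  abel

/-- The invariant grows by exactly (2 - T)†(1 - S)(2 - T) + T†(S - S²)T + 4(S - S²), and each term
is positive because S² ≤ S ≤ 1. -/
theorem UnionBound.step {E T S : Matrix X X ℂ} (h : UnionBound E T) (hS : Sᴴ = S)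
    (h1 : (1 - S).PosSemidef) (h2 : (S - S * S).PosSemidef) :
    UnionBound (E + (1 - S * S)) (S * T) := by
  have ha := h1.conjTranspose_mul_mul_same (2 • (1 : Matrix X X ℂ) - T)
  have hb := h2.conjTranspose_mul_mul_same T
  have hc : (4 • (S - S * S)).PosSemidef := by
    have : 4 • (S - S * S) = (S - S * S) + (S - S * S) + (S - S * S) + (S - S * S) := by abel
    rw [this]
    exact ((h2.add h2).add h2).add h2
  have := ((PosSemidef.add h ha).add hb).add hc
  rw [UnionBound]
  convert this using 1
  simp only [conjTranspose_mul, hS, conjTranspose_sub, conjTranspose_nsmul, conjTranspose_one]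
  generalize Tᴴ = T'
  noncomm_ring

/-- The quantum union bound in operator form. -/
theorem UnionBound.le {E T : Matrix X X ℂ} (h : UnionBound E T) :
    (4 • E - (1 - Tᴴ * T)).PosSemidef := by
  -- Adding 2(1 - T)†(1 - T) to the invariant cancels the terms linear in T.
  have h2 := posSemidef_conjTranspose_mul_self (1 - T)
  have := (PosSemidef.add h h2).add h2
  convert this using 1
  simp only [conjTranspose_sub, conjTranspose_one]
  generalize Tᴴ = T'
  noncomm_ring

/-- Testing a list of effects one after the other until one of them accepts. -/
theorem exists_sequential_test (K : ℕ) (Λ : Fin K → Matrix X X ℂ) (h0 : ∀ m, (Λ m).PosSemidef)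
    (h1 : ∀ m, (1 - Λ m).PosSemidef) :
    ∃ (F : Fin K → Matrix X X ℂ) (R : Matrix X X ℂ), Rᴴ * R = 1 - ∑ m, (F m)ᴴ * F m ∧
      (∀ E T, UnionBound E T → UnionBound (E + ∑ j, Λ j) (R * T)) ∧
      ∀ m E T, UnionBound E T →
        UnionBound (E + ∑ j, if j = m then 1 - Λ j else Λ j) (F m * T) := by
  induction K with
  | zero => exact ⟨0, 1, by simp, by simp, fun m => m.elim0⟩
  | succ K ih =>
    obtain ⟨F, R, hR, hRu, hF⟩ := ih (fun m => Λ m.castSucc) (fun m => h0 _) (fun m => h1 _)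
    obtain ⟨S, hS, hSS, hS1⟩ := exists_sqrt (h0 (Fin.last K))
    obtain ⟨Q, hQ, hQQ, hQ1⟩ := exists_sqrt (h1 (Fin.last K))
    obtain ⟨hS1, hS2⟩ := hS1 (h1 _)
    obtain ⟨hQ1, hQ2⟩ := hQ1 (by simpa using h0 (Fin.last K))
    rw [← hSS] at hS2
    rw [← hQQ] at hQ2
    -- With S = √Λ and Q = √(1 - Λ) for the last test, F m rejects in all tests before m and accepts
    -- in test m, while R rejects in all of them.
    refine ⟨Fin.snoc F (S * R), Q * R, ?_, fun E T h => ?_, fun m => ?_⟩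
    · rw [Fin.sum_univ_castSucc]
      simp only [Fin.snoc_castSucc, Fin.snoc_last, conjTranspose_mul, hS, hQ]
      rw [← sub_sub, ← hR]
      calc _ = Rᴴ * (Q * Q) * R := by simp only [mul_assoc]
        _ = Rᴴ * R - Rᴴ * (S * S) * R := by rw [hQQ, hSS]; noncomm_ring
        _ = _ := by simp only [mul_assoc]
    · rw [Fin.sum_univ_castSucc, mul_assoc, ← add_assoc]
      have := (hRu E T h).step hQ hQ1 hQ2
      rwa [hQQ, sub_sub_cancel] at this
    · refine Fin.lastCases (fun E T h => ?_) (fun m E T h => ?_) m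
      · rw [Fin.sum_univ_castSucc, ← add_assoc]
        have := (hRu E T h).step hS hS1 hS2
        rw [hSS] at this
        simpa [Fin.castSucc_ne_last, mul_assoc] using this
      · rw [Fin.sum_univ_castSucc, ← add_assoc]
        simpa [(Fin.castSucc_ne_last m).symm] using (hF m E T h).mono (h0 (Fin.last K))

/-- Two sequential tests performed in a row, as a measurement of both outcomes. -/
theorem exists_measurement {K₁ K₂ : ℕ} (hK₁ : 0 < K₁) (hK₂ : 0 < K₂)
    (Λ : Fin K₁ → Matrix X X ℂ) (hΛ0 : ∀ m, (Λ m).PosSemidef) (hΛ1 : ∀ m, (1 - Λ m).PosSemidef)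
    (Γ : Fin K₂ → Matrix X X ℂ) (hΓ0 : ∀ m, (Γ m).PosSemidef) (hΓ1 : ∀ m, (1 - Γ m).PosSemidef) :
    ∃ Ω : Fin K₁ × Fin K₂ → Matrix X X ℂ, (∀ m, (Ω m).PosSemidef) ∧ ∑ m, Ω m = 1 ∧
      ∀ m : Fin K₁ × Fin K₂, (4 • ((∑ j, if j = m.1 then 1 - Λ j else Λ j) +
        ∑ j, if j = m.2 then 1 - Γ j else Γ j) - (1 - Ω m)).PosSemidef := by
  obtain ⟨F, R, hR, -, hF⟩ := exists_sequential_test K₁ Λ hΛ0 hΛ1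
  obtain ⟨G, Q, hQ, -, hG⟩ := exists_sequential_test K₂ Γ hΓ0 hΓ1
  set T : Fin K₁ × Fin K₂ → Matrix X X ℂ := fun m => G m.2 * F m.1 with hT
  set P : Matrix X X ℂ := 1 - ∑ m, (T m)ᴴ * T m with hPdef
  -- P is the event that one of the two rounds ends without acceptance. It is assigned to the
  -- outcome (0, 0), which only enlarges that element.
  have hP : P.PosSemidef := by
    have : P = Rᴴ * R + ∑ m, (Q * F m)ᴴ * (Q * F m) := by
      have e1 : ∀ m, (Q * F m)ᴴ * (Q * F m) =
          (F m)ᴴ * F m - ∑ n, (T (m, n))ᴴ * T (m, n) := by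
        intro m
        calc _ = (F m)ᴴ * (Qᴴ * Q) * F m := by simp only [conjTranspose_mul, mul_assoc]
          _ = (F m)ᴴ * F m - ∑ n, (F m)ᴴ * ((G n)ᴴ * G n) * F m := by
            rw [hQ, mul_sub, sub_mul, mul_one, Finset.mul_sum, Finset.sum_mul]
          _ = _ := by simp only [hT, conjTranspose_mul, mul_assoc]
      rw [hPdef, Fintype.sum_prod_type]
      simp only [e1, sum_sub_distrib]
      rw [hR]
      abel
    rw [this]
    exact (posSemidef_conjTranspose_mul_self R).add
      (posSemidef_sum _ fun m _ => posSemidef_conjTranspose_mul_self _)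
  refine ⟨fun m => (T m)ᴴ * T m + if m = (⟨0, hK₁⟩, ⟨0, hK₂⟩) then P else 0,
    fun m => ?_, ?_, fun m => ?_⟩
  · refine (posSemidef_conjTranspose_mul_self _).add ?_
    split_ifs
    exacts [hP, PosSemidef.zero]
  · rw [sum_add_distrib, Finset.sum_ite_eq']
    simp [hPdef]
  · have h1 := (hG m.2 _ _ (hF m.1 _ _ unionBound_zero_one)).le
    rw [zero_add, mul_one] at h1
    have h2 : (if m = (⟨0, hK₁⟩, ⟨0, hK₂⟩) then P else 0).PosSemidef := by
      split_ifs
      exacts [hP, PosSemidef.zero]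
    convert h1.add h2 using 1
    simp only [hT]
    abel

end Sequential

/-! ### Channels as measurements, and measure-and-prepare channels -/

section Channels

variable {X Y : Type*} [Fintype X] [Fintype Y]

theorem IsChannel.posSemidef {N : Matrix X X ℂ →ₗ[ℂ] Matrix Y Y ℂ} (hN : IsChannel N)
    {M : Matrix X X ℂ} (hM : M.PosSemidef) : (N M).PosSemidef :=
  (hN.completelyPositive 1 (M.submatrix Prod.fst Prod.fst) (hM.submatrix _)).submatrix
    fun y => (y, (0 : Fin 1))

theorem IsChannel.isState {N : Matrix X X ℂ →ₗ[ℂ] Matrix Y Y ℂ} (hN : IsChannel N)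
    {M : Matrix X X ℂ} (hM : IsState M) : IsState (N M) :=
  ⟨hN.posSemidef hM.1, by rw [hN.tracePreserving, hM.2]⟩

variable [DecidableEq X]

/-- The measurement of the output of a channel in the computational basis, as a measurement of
its input. -/
theorem IsChannel.exists_measurement {D : Matrix X X ℂ →ₗ[ℂ] Matrix Y Y ℂ} (hD : IsChannel D) :
    ∃ Ω : Y → Matrix X X ℂ, (∀ y, (Ω y).PosSemidef) ∧ ∑ y, Ω y = 1 ∧
      ∀ y M, D M y y = (Ω y * M).trace := by
  -- Ω y represents the functional M ↦ (D M) y y under the trace pairing, hence the swapped indices.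
  -- Rank-one inputs show that it is positive, and trace preservation gives the sum 1.
  have key : ∀ y M, D M y y = ((Matrix.of fun c' c => D (Matrix.single c c' 1) y y) * M).trace := by
    intro y M
    conv_lhs => rw [matrix_eq_sum_single M]
    simp only [map_sum, Matrix.sum_apply, trace, diag_apply, mul_apply, of_apply]
    rw [Finset.sum_comm]
    refine sum_congr rfl fun i _ => sum_congr rfl fun j _ => ?_
    have : Matrix.single j i (M j i) = M j i • Matrix.single j i (1 : ℂ) := by simp
    rw [this, map_smul, Matrix.smul_apply, smul_eq_mul, mul_comm]
  refine ⟨fun y => Matrix.of fun c' c => D (Matrix.single c c' 1) y y, fun y => ?_, ?_, key⟩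
  · refine posSemidef_of_dotProduct fun x => ?_
    have h1 := (hD.posSemidef (posSemidef_vecMulVec_self_star x)).diag_nonneg (i := y)
    rw [key, mul_vecMulVec, trace_vecMulVec] at h1
    rwa [dotProduct_comm]
  · ext c' c
    rw [Matrix.sum_apply]
    have h1 := hD.tracePreserving (Matrix.single c c' 1)
    have h2 : (Matrix.single c c' (1 : ℂ)).trace = if c' = c then 1 else 0 := by
      split_ifs with h
      · rw [h]; exact trace_single_eq_same _ _
      · exact trace_single_eq_of_ne _ _ _ (Ne.symm h)
    rw [h2] at h1
    rw [Matrix.one_apply, ← h1]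
    rfl

/-- The entanglement breaking map which measures `Ω` and prepares `σ m` on outcome `m`. -/
def measurePrepare {I : Type*} [Fintype I] (Ω : I → Matrix X X ℂ) (σ : I → Matrix Y Y ℂ) :
    Matrix X X ℂ →ₗ[ℂ] Matrix Y Y ℂ where
  toFun M := ∑ i, (Ω i * M).trace • σ i
  map_add' M M' := by simp [mul_add, add_smul, sum_add_distrib]
  map_smul' z M := by simp [smul_smul, Finset.smul_sum]

omit [Fintype Y] in
theorem measurePrepare_apply {I : Type*} [Fintype I] (Ω : I → Matrix X X ℂ) (σ : I → Matrix Y Y ℂ)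
    (M : Matrix X X ℂ) : measurePrepare Ω σ M = ∑ i, (Ω i * M).trace • σ i := rfl

/-- With a reference register the output is the sum of σ_i ⊗ Tr_X((Ω_i ⊗ 1)M). Writing Ω_i = B†B
makes the second factor a partial trace of (B ⊗ 1)M(B ⊗ 1)†, which is positive. -/
theorem isChannel_measurePrepare {I : Type*} [Fintype I] {Ω : I → Matrix X X ℂ}
    {σ : I → Matrix Y Y ℂ} (hΩ : ∀ i, (Ω i).PosSemidef) (hΩ1 : ∑ i, Ω i = 1)
    (hσ : ∀ i, IsState (σ i)) : IsChannel (measurePrepare Ω σ) where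
  completelyPositive n M hM := by
    have h1 : ∀ i, (Matrix.of fun s s' : Fin n =>
        (Ω i * Matrix.of fun x x' => M (x, s) (x', s')).trace).PosSemidef := by
      intro i
      obtain ⟨B, hB⟩ := posSemidef_exists_conjTranspose_mul (hΩ i)
      have h2 := hM.mul_mul_conjTranspose_same (B ⊗ₖ (1 : Matrix (Fin n) (Fin n) ℂ))
      have h3 := posSemidef_sum Finset.univ
        fun (k : X) _ => h2.submatrix fun s : Fin n => (k, s)
      convert h3 using 1
      ext s s'
      rw [of_apply, hB, mul_assoc, trace_mul_comm, Matrix.sum_apply, trace]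
      refine sum_congr rfl fun k _ => ?_
      simp only [diag_apply, submatrix_apply, mul_apply, conjTranspose_apply, kroneckerMap_apply,
        Fintype.sum_prod_type, of_apply, Matrix.one_apply]
      simp [apply_ite (starRingEnd ℂ)]
    have h4 : applyFst (measurePrepare Ω σ) M = ∑ i, σ i ⊗ₖ (Matrix.of fun s s' : Fin n =>
        (Ω i * Matrix.of fun x x' => M (x, s) (x', s')).trace) := by
      ext p q
      simp only [applyFst, measurePrepare_apply, of_apply, Matrix.sum_apply,
        Matrix.smul_apply, smul_eq_mul, kroneckerMap_apply]
      exact sum_congr rfl fun i _ => mul_comm _ _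
    rw [h4]
    exact posSemidef_sum _ fun i _ => (hσ i).1.kronecker (h1 i)
  tracePreserving M := by
    rw [measurePrepare_apply, trace_sum]
    simp only [trace_smul, (hσ _).2, smul_eq_mul, mul_one]
    rw [← trace_sum, ← Finset.sum_mul, hΩ1, one_mul]

theorem isState_single (x : X) : IsState (Matrix.single x x (1 : ℂ)) := by
  refine ⟨?_, trace_single_eq_same _ _⟩
  have : Matrix.single x x (1 : ℂ) = diagonal (Pi.single x 1) := (diagonal_single x 1).symm
  rw [this]
  refine PosSemidef.diagonal fun i => ?_
  by_cases h : i = x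
  · subst h; simp
  · simp [h]

theorem IsState.one_sub {ρ : Matrix X X ℂ} (h : IsState ρ) : (1 - ρ).PosSemidef := by
  simpa [h.2] using posSemidef_trace_smul_one_sub h.1

omit [DecidableEq X] in
theorem IsState.nonempty {ρ : Matrix X X ℂ} (h : IsState ρ) : Nonempty X := by
  by_contra hX
  rw [not_nonempty_iff] at hX
  simpa [trace] using h.2

omit [DecidableEq X] in
theorem IsState.kronecker {ρ : Matrix X X ℂ} {σ : Matrix Y Y ℂ} (h : IsState ρ)
    (h' : IsState σ) : IsState (ρ ⊗ₖ σ) :=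
  ⟨h.1.kronecker h'.1, by rw [trace_kronecker, h.2, h'.2, one_mul]⟩

end Channels

/-! ### Operators with a classical register -/

section Blocks

variable {C U : Type*}

/-- The block of an operator on `C × U` at the value `u` of the classical register `U`. -/
def block (τ : Matrix (C × U) (C × U) ℂ) (u : U) : Matrix C C ℂ :=
  τ.submatrix (fun c => (c, u)) fun c => (c, u)

/-- Block diagonality with respect to the second register. -/
def IsBlockDiag (τ : Matrix (C × U) (C × U) ℂ) : Prop :=
  ∀ p q, p.2 ≠ q.2 → τ p q = 0

variable [Fintype C] [Fintype U] {τ : Matrix (C × U) (C × U) ℂ}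

/-- Only the diagonal blocks of Λ meet τ, so a test on C × U amounts to a family of tests on C
indexed by U. -/
theorem IsBlockDiag.trace_mul (hτ : IsBlockDiag τ) (Λ : Matrix (C × U) (C × U) ℂ) :
    (Λ * τ).trace = ∑ u, (block Λ u * block τ u).trace := by
  simp only [trace, diag_apply, mul_apply, Fintype.sum_prod_type, block, submatrix_apply]
  rw [Finset.sum_comm]
  refine sum_congr rfl fun u _ => sum_congr rfl fun c _ => sum_congr rfl fun c' _ => ?_
  refine Finset.sum_eq_single u (fun u' _ h => ?_) (by simp)
  rw [hτ _ _ h, mul_zero]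

omit [Fintype C] in
theorem traceSnd_eq_sum_block : traceSnd τ = ∑ u, block τ u := by
  ext c c'
  simp [traceSnd, block, Matrix.sum_apply]

omit [Fintype U] in
theorem IsBlockDiag.traceFst_eq [DecidableEq U] (hτ : IsBlockDiag τ) :
    traceFst τ = diagonal fun u => (block τ u).trace := by
  ext u u'
  rw [diagonal_apply]
  split_ifs with h
  · subst h; rfl
  · exact Finset.sum_eq_zero fun c _ => hτ _ _ h

omit [Fintype C] [Fintype U] in
theorem isBlockDiag_kronecker_diagonal [DecidableEq U] (σ : Matrix C C ℂ) (p : U → ℂ) :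
    IsBlockDiag (σ ⊗ₖ diagonal p) := fun x y h => by
  simp [diagonal_apply_ne _ h]

omit [Fintype C] [Fintype U] in
theorem block_kronecker_diagonal [DecidableEq U] (σ : Matrix C C ℂ) (p : U → ℂ) (u : U) :
    block (σ ⊗ₖ diagonal p) u = p u • σ := by
  ext c c'
  simp [block, mul_comm]

omit [Fintype C] [Fintype U] in
theorem block_blockDiagonal [DecidableEq U] (Λ : U → Matrix C C ℂ) (u : U) :
    block (blockDiagonal Λ) u = Λ u := by
  ext c c'
  simp [block, blockDiagonal_apply]

theorem posSemidef_blockDiagonal [DecidableEq C] [DecidableEq U] {Λ : U → Matrix C C ℂ}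
    (h : ∀ u, (Λ u).PosSemidef) : (blockDiagonal Λ).PosSemidef := by
  choose B hB using fun u => posSemidef_exists_conjTranspose_mul (h u)
  have : blockDiagonal Λ = (blockDiagonal B)ᴴ * blockDiagonal B := by
    rw [blockDiagonal_conjTranspose, ← blockDiagonal_mul]
    exact congrArg _ (funext hB)
  rw [this]
  exact posSemidef_conjTranspose_mul_self _

theorem IsBlockDiag.trace_mul_kronecker [DecidableEq U] (hτ : IsBlockDiag τ)
    (Λ : Matrix (C × U) (C × U) ℂ) (σ : Matrix C C ℂ) :
    (Λ * (σ ⊗ₖ traceFst τ)).trace = ∑ u, (block τ u).trace * (block Λ u * σ).trace := by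
  rw [hτ.traceFst_eq, (isBlockDiag_kronecker_diagonal _ _).trace_mul]
  simp only [block_kronecker_diagonal, Matrix.mul_smul, trace_smul, smul_eq_mul]

end Blocks

/-! ### Divergence bounds and conditional tests -/

section HypothesisTesting

variable {C U : Type*} [Fintype C] [DecidableEq C] [Fintype U] [DecidableEq U]
  {τ : Matrix (C × U) (C × U) ℂ}

/-- A lower bound for the divergence by a test that is conditioned on the classical register. -/
theorem le_hypoDiv (hτ : IsBlockDiag τ) {Λ : U → Matrix C C ℂ} (h0 : ∀ u, (Λ u).PosSemidef)
    (h1 : ∀ u, (1 - Λ u).PosSemidef) {p : U → ℝ} (hp : ∀ u, (block τ u).trace = p u)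
    (hp0 : ∀ u, 0 ≤ p u) {ε : ℝ} (hε : 1 - ε ≤ ∑ u, (Λ u * block τ u).trace.re)
    {σ : Matrix C C ℂ} (hσ : σ.PosSemidef) {R K : ℝ} (hK : K = 2 ^ R)
    (hR : K * ∑ u, p u * (Λ u * σ).trace.re ≤ 1) :
    (R : EReal) ≤ hypoDiv ε τ (σ ⊗ₖ traceFst τ) := by
  have hmem : blockDiagonal Λ ∈ {Λ : Matrix (C × U) (C × U) ℂ |
      Λ.PosSemidef ∧ (1 - Λ).PosSemidef ∧ 1 - ε ≤ (Λ * τ).trace.re} := by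
    refine ⟨posSemidef_blockDiagonal h0, ?_, ?_⟩
    · rw [← blockDiagonal_one, ← blockDiagonal_sub]
      exact posSemidef_blockDiagonal h1
    · rw [hτ.trace_mul, Complex.re_sum]
      simpa only [block_blockDiagonal] using hε
  refine le_trans ?_ (le_iSup₂ (f := fun Λ _ => logInv (Λ * (σ ⊗ₖ traceFst τ)).trace.re) _ hmem)
  have ht : (blockDiagonal Λ * (σ ⊗ₖ traceFst τ)).trace.re = ∑ u, p u * (Λ u * σ).trace.re := by
    rw [hτ.trace_mul_kronecker, Complex.re_sum]
    simp only [block_blockDiagonal, hp, Complex.re_ofReal_mul]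
  simp only [ht]
  set t := ∑ u, p u * (Λ u * σ).trace.re with htdef
  have ht0 : 0 ≤ t := sum_nonneg fun u _ => mul_nonneg (hp0 u) (re_trace_mul_nonneg (h0 u) hσ)
  rw [logInv]
  split_ifs with h
  · exact le_top
  · have htpos : 0 < t := lt_of_le_of_ne ht0 (Ne.symm h)
    rw [EReal.coe_le_coe_iff, Real.le_logb_iff_rpow_le (by norm_num) (by positivity), ← hK,
      le_div_iff₀ htpos]
    exact hR

/-- Tests witnessing that the divergence is large, conditioned on the classical register. -/
theorem exists_test_of_le_hypoDiv (hτ : IsBlockDiag τ) {p : U → ℝ}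
    (hp : ∀ u, (block τ u).trace = p u) {ε δ R : ℝ} (hδ : 0 < δ) {K : ℕ} (hK : (K : ℝ) = 2 ^ R)
    (h : (R : EReal) ≤ hypoDiv ε τ (traceSnd τ ⊗ₖ traceFst τ) -
      ((Real.logb 2 (1 / δ) : ℝ) : EReal)) :
    ∃ Λ : U → Matrix C C ℂ, (∀ u, (Λ u).PosSemidef) ∧ (∀ u, (1 - Λ u).PosSemidef) ∧
      1 - ε ≤ ∑ u, (Λ u * block τ u).trace.re ∧
      ((K : ℝ) - 1) * ∑ u, p u * (Λ u * ∑ u', block τ u').trace.re ≤ δ := by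
  have hK0 : 0 < (K : ℝ) := hK ▸ by positivity
  have hK1 : (1 : ℝ) ≤ K := by exact_mod_cast Nat.one_le_iff_ne_zero.mpr (by
    rintro rfl; simp at hK0)
  rw [EReal.le_sub_iff_add_le (by simp) (by simp), ← EReal.coe_add] at h
  -- Attainment of the supremum is avoided: replacing K by K - 1/2 makes the inequality strict, so
  -- some test beats it. This loses nothing, as only K - 1 wrong codewords count.
  have hlt : ((Real.logb 2 ((K - 1 / 2) / δ) : ℝ) : EReal) <
      hypoDiv ε τ (traceSnd τ ⊗ₖ traceFst τ) := by
    refine lt_of_lt_of_le ?_ h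
    rw [EReal.coe_lt_coe_iff]
    have hR : R = Real.logb 2 K := by
      rw [hK, Real.logb_rpow] <;> norm_num
    rw [hR, ← Real.logb_mul (by positivity) (by positivity)]
    refine Real.logb_lt_logb (by norm_num) (div_pos (by linarith) hδ) ?_
    rw [mul_one_div]
    exact div_lt_div_of_pos_right (by linarith) hδ
  obtain ⟨Λ, hΛ⟩ := lt_iSup_iff.mp hlt
  obtain ⟨⟨h0, h1, h2⟩, hΛ⟩ := lt_iSup_iff.mp hΛ
  refine ⟨block Λ, fun u => h0.submatrix _, fun u => ?_, ?_, ?_⟩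
  · have : 1 - block Λ u = block (1 - Λ) u := by
      ext c c'
      simp [block, Matrix.one_apply]
    rw [this]
    exact h1.submatrix _
  · rwa [hτ.trace_mul, Complex.re_sum] at h2
  · have ht : (Λ * (traceSnd τ ⊗ₖ traceFst τ)).trace.re =
        ∑ u, p u * (block Λ u * ∑ u', block τ u').trace.re := by
      rw [hτ.trace_mul_kronecker, Complex.re_sum, traceSnd_eq_sum_block]
      simp only [hp, Complex.re_ofReal_mul]
    rw [ht] at hΛ
    set t := ∑ u, p u * (block Λ u * ∑ u', block τ u').trace.re
    rcases le_or_gt t 0 with ht0 | ht0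
    -- This case includes t = 0, where `logInv` is infinite.
    · exact le_trans (mul_nonpos_of_nonneg_of_nonpos (by linarith) ht0) hδ.le
    · rw [logInv, if_neg ht0.ne', EReal.coe_lt_coe_iff,
        Real.logb_lt_logb_iff (by norm_num) (div_pos (by linarith) hδ) (by positivity),
        div_lt_div_iff₀ hδ ht0] at hΛ
      linarith

end HypothesisTesting

/-! ### Channel outputs for classical-quantum inputs -/

section Outputs

variable {A B C U V : Type*} (N : Matrix (A × B) (A × B) ℂ →ₗ[ℂ] Matrix C C ℂ)
  {ψ : Matrix (U × A) (U × A) ℂ} {φ : Matrix (V × B) (V × B) ℂ}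

/-- The subnormalized state of `X` conditioned on the value `u` of a classical register. -/
def condState {X : Type*} (ψ : Matrix (U × X) (U × X) ℂ) (u : U) : Matrix X X ℂ :=
  ψ.submatrix (fun x => (u, x)) fun x => (u, x)

theorem block_margCU [Fintype V] (u : U) : block (margCU (macOutput N ψ φ)) u =
    ∑ v, N (condState ψ u ⊗ₖ condState φ v) := by
  ext c c'
  rw [Matrix.sum_apply]
  rfl

theorem block_margCV [Fintype U] (v : V) : block (margCV (macOutput N ψ φ)) v =
    ∑ u, N (condState ψ u ⊗ₖ condState φ v) := by
  ext c c'
  rw [Matrix.sum_apply]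
  rfl

theorem isBlockDiag_margCU [Fintype V] (hψ : ∀ u u' x x', u ≠ u' → ψ (u, x) (u', x') = 0) :
    IsBlockDiag (margCU (macOutput N ψ φ)) := fun p q h => by
  refine Finset.sum_eq_zero fun v _ => ?_
  have : (Matrix.of fun x x' : A × B => ((ψ ⊗ₖ φ).submatrix
      (fun i : (A × B) × (U × V) => ((i.2.1, i.1.1), (i.2.2, i.1.2)))
      (fun i : (A × B) × (U × V) => ((i.2.1, i.1.1), (i.2.2, i.1.2))))
        (x, (p.2, v)) (x', (q.2, v))) = 0 := by
    ext x x'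
    simp [hψ _ _ _ _ h]
  simp only [macOutput, applyFst, of_apply]
  rw [this, map_zero, Matrix.zero_apply]

theorem isBlockDiag_margCV [Fintype U] (hφ : ∀ v v' x x', v ≠ v' → φ (v, x) (v', x') = 0) :
    IsBlockDiag (margCV (macOutput N ψ φ)) := fun p q h => by
  refine Finset.sum_eq_zero fun u _ => ?_
  have : (Matrix.of fun x x' : A × B => ((ψ ⊗ₖ φ).submatrix
      (fun i : (A × B) × (U × V) => ((i.2.1, i.1.1), (i.2.2, i.1.2)))
      (fun i : (A × B) × (U × V) => ((i.2.1, i.1.1), (i.2.2, i.1.2))))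
        (x, (u, p.2)) (x', (u, q.2))) = 0 := by
    ext x x'
    simp [hφ _ _ _ _ h]
  simp only [macOutput, applyFst, of_apply]
  rw [this, map_zero, Matrix.zero_apply]

/-- A classical-quantum state is an ensemble of states. -/
theorem IsCQState.exists_ensemble [Fintype U] [Fintype A] (h : IsCQState ψ) :
    ∃ (p : U → ℝ) (α : U → Matrix A A ℂ), (∀ u, 0 ≤ p u) ∧ ∑ u, p u = 1 ∧ (∀ u, IsState (α u)) ∧
      ∀ u, condState ψ u = (p u : ℂ) • α u := by
  classical
  have hpos : ∀ u, (condState ψ u).PosSemidef := fun u => h.1.1.submatrix _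
  have htr : ∀ u, (condState ψ u).trace = ((condState ψ u).trace.re : ℂ) := fun u =>
    Complex.ext rfl (by simpa using (Complex.nonneg_iff.mp (hpos u).trace_nonneg).2.symm)
  have hsum : ∑ u, (condState ψ u).trace = 1 := by
    rw [← h.1.2, trace, Fintype.sum_prod_type]
    rfl
  obtain ⟨x⟩ : Nonempty A := by
    obtain ⟨x⟩ := h.1.nonempty
    exact ⟨x.2⟩
  -- A positive block of trace zero vanishes, so any state can serve as the conditional state there.
  refine ⟨fun u => (condState ψ u).trace.re, fun u => if (condState ψ u).trace = 0 then
    Matrix.single x x 1 else (condState ψ u).trace⁻¹ • condState ψ u, fun u => ?_, ?_, fun u => ?_,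
    fun u => ?_⟩
  · exact (Complex.nonneg_iff.mp (hpos u).trace_nonneg).1
  · rw [← Complex.re_sum, hsum, Complex.one_re]
  · dsimp only
    split_ifs with h0
    · exact isState_single x
    · refine ⟨(hpos u).smul (inv_nonneg.mpr (hpos u).trace_nonneg), ?_⟩
      rw [trace_smul, smul_eq_mul, inv_mul_cancel₀ h0]
  · simp only [← htr]
    split_ifs with h0
    · rw [h0, zero_smul, (hpos u).trace_eq_zero_iff.mp h0]
    · rw [smul_smul, mul_inv_cancel₀ h0, one_smul]

/-- The classical-quantum state with a uniformly distributed classical register. -/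
def uniformCQ {k : ℕ} (α : Fin k → Matrix A A ℂ) : Matrix (Fin k × A) (Fin k × A) ℂ :=
  ((1 / k : ℂ) • blockDiagonal α).submatrix Prod.swap Prod.swap

theorem condState_uniformCQ {k : ℕ} (α : Fin k → Matrix A A ℂ) (u : Fin k) :
    condState (uniformCQ α) u = (1 / k : ℂ) • α u := by
  ext a a'
  simp [condState, uniformCQ, blockDiagonal_apply]

theorem traceSnd_uniformCQ [Fintype A] {k : ℕ} {α : Fin k → Matrix A A ℂ}
    (hα : ∀ u, IsState (α u)) : traceSnd (uniformCQ α) = (1 / (k : ℂ)) • 1 := by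
  ext u u'
  simp only [traceSnd, uniformCQ, of_apply, submatrix_apply, Matrix.smul_apply, Prod.swap_prod_mk,
    blockDiagonal_apply, Matrix.one_apply, smul_eq_mul]
  split_ifs with h
  · rw [← Finset.mul_sum]
    congr 1
    exact (hα u).2
  · simp

theorem isCQState_uniformCQ [Fintype A] {k : ℕ} (hk : 0 < k) {α : Fin k → Matrix A A ℂ}
    (hα : ∀ u, IsState (α u)) : IsCQState (uniformCQ α) := by
  classical
  refine ⟨⟨?_, ?_⟩, fun u u' x x' h => ?_⟩
  · exact ((posSemidef_blockDiagonal fun u => (hα u).1).smul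
      (by rw [one_div, inv_nonneg]; exact Nat.cast_nonneg k)).submatrix _
  · have : (uniformCQ α).trace = (traceSnd (uniformCQ α)).trace := by
      rw [trace, Fintype.sum_prod_type]
      rfl
    rw [this, traceSnd_uniformCQ hα, trace_smul, trace_one, Fintype.card_fin, smul_eq_mul,
      one_div_mul_cancel (by exact_mod_cast hk.ne')]
  · simp [uniformCQ, blockDiagonal_apply, h]

end Outputs

/-! ### Expectations over random codebooks -/

section RandomCoding

variable {U : Type*} [Fintype U] {K : ℕ} {p : U → ℝ}

/-- The probability of a codebook with independent entries. -/
def codebookProb (p : U → ℝ) (x : Fin K → U) : ℝ := ∏ i, p (x i)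

theorem sum_prod_apply (g : Fin K → U → ℝ) :
    ∑ x : Fin K → U, ∏ i, g i (x i) = ∏ i, ∑ u, g i u := by
  classical
  rw [Finset.prod_univ_sum]
  simp

theorem sum_codebookProb (hp : ∑ u, p u = 1) : ∑ x : Fin K → U, codebookProb p x = 1 := by
  simp [codebookProb, sum_prod_apply fun _ => p, hp]

theorem sum_codebookProb_mul₁ (hp : ∑ u, p u = 1) (m : Fin K) (g : U → ℝ) :
    ∑ x : Fin K → U, codebookProb p x * g (x m) = ∑ u, p u * g u := by
  have h := sum_prod_apply fun (i : Fin K) u => p u * if i = m then g u else 1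
  simp only [Finset.prod_mul_distrib, Finset.prod_ite_eq', Finset.mem_univ, if_true] at h
  refine Eq.trans h ?_
  rw [Finset.prod_eq_single m]
  · simp
  · intro j _ hj
    simp [hj, hp]
  · simp

theorem sum_codebookProb_mul₂ (hp : ∑ u, p u = 1) {m j : Fin K} (hj : j ≠ m) (f : U → U → ℝ) :
    ∑ x : Fin K → U, codebookProb p x * f (x j) (x m) = ∑ u, ∑ u', p u * p u' * f u' u := by
  classical
  -- Fixing x m = u turns the summand into a product over the entries, which `sum_prod_apply`
  -- factorises.
  have key : ∀ u : U, ∑ x : Fin K → U, codebookProb p x * (f (x j) u * if x m = u then 1 else 0) =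
      ∑ u', p u * p u' * f u' u := by
    intro u
    have h := sum_prod_apply fun (i : Fin K) w =>
      p w * ((if i = j then f w u else 1) * if i = m then (if w = u then 1 else 0) else 1)
    simp only [Finset.prod_mul_distrib, Finset.prod_ite_eq', Finset.mem_univ, if_true] at h
    refine Eq.trans h ?_
    rw [← Finset.mul_prod_erase _ _ (Finset.mem_univ m),
      ← Finset.mul_prod_erase _ _ (Finset.mem_erase.mpr ⟨hj, Finset.mem_univ j⟩),
      Finset.prod_eq_one]
    · simp [hj, hj.symm, Finset.mul_sum, mul_assoc]
    · intro i hi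
      simp only [Finset.mem_erase] at hi
      simp [hi.1, hi.2.1, hp]
  rw [← Finset.sum_congr rfl fun u _ => key u, Finset.sum_comm]
  refine sum_congr rfl fun x _ => ?_
  rw [← Finset.mul_sum]
  simp

/-- The expected cost of the sequential decoding of the message `m`, where `a u' u` is the
probability that the test for the codeword `u'` accepts when the codeword `u` is sent. -/
theorem expected_cost_le (hp : ∑ u, p u = 1) {a : U → U → ℝ} {ε δ : ℝ}
    (h1 : 1 - ε ≤ ∑ u, p u * a u u) (h2 : ((K : ℝ) - 1) * ∑ u, ∑ u', p u * p u' * a u' u ≤ δ)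
    (m : Fin K) :
    ∑ x : Fin K → U, codebookProb p x *
      ∑ j, (if j = m then 1 - a (x j) (x m) else a (x j) (x m)) ≤ ε + δ := by
  have e : ∀ j, ∑ x : Fin K → U, codebookProb p x *
      (if j = m then 1 - a (x j) (x m) else a (x j) (x m)) =
      if j = m then 1 - ∑ u, p u * a u u else ∑ u, ∑ u', p u * p u' * a u' u := by
    intro j
    split_ifs with hj
    · subst hj
      simp only [mul_sub, mul_one, sum_sub_distrib, sum_codebookProb hp]
      rw [sum_codebookProb_mul₁ hp j fun u => a u u]
    · exact sum_codebookProb_mul₂ hp hj a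
  simp only [Finset.mul_sum]
  rw [Finset.sum_comm, Finset.sum_congr rfl fun j _ => e j,
    ← Finset.add_sum_erase _ _ (Finset.mem_univ m),
    Finset.sum_congr rfl fun j hj => if_neg (Finset.ne_of_mem_erase hj)]
  have hK : 1 ≤ K := m.pos
  rw [if_pos rfl, Finset.sum_const, Finset.card_erase_of_mem (Finset.mem_univ _), Finset.card_univ,
    Fintype.card_fin, nsmul_eq_mul, Nat.cast_sub hK, Nat.cast_one]
  linarith

theorem exists_le_of_average {I : Type*} [Fintype I] {w J : I → ℝ} {b : ℝ} (hw : ∀ i, 0 ≤ w i)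
    (hw1 : ∑ i, w i = 1) (h : ∑ i, w i * J i ≤ b) : ∃ i, J i ≤ b := by
  by_contra! hJ
  have h0 : ∑ i, w i * (J i - b) ≤ 0 := by
    simp only [mul_sub, sum_sub_distrib, ← Finset.sum_mul, hw1]
    linarith
  have h2 : ∀ i ∈ Finset.univ, 0 ≤ w i * (J i - b) := fun i _ =>
    mul_nonneg (hw i) (sub_nonneg.mpr (hJ i).le)
  have h3 := (Finset.sum_eq_zero_iff_of_nonneg h2).mp (le_antisymm h0 (Finset.sum_nonneg h2))
  have h4 : ∑ i, w i = 0 := Finset.sum_eq_zero fun i hi =>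
    (mul_eq_zero.mp (h3 i hi)).resolve_right (sub_pos.mpr (hJ i)).ne'
  rw [hw1] at h4
  exact one_ne_zero h4

end RandomCoding

/-! ### Error probabilities of a code -/

namespace MACCode

variable {A B C : Type*} [Fintype A] [Fintype B] [Fintype C] {K₁ K₂ : ℕ}
  (c : MACCode A B C K₁ K₂) {N : Matrix (A × B) (A × B) ℂ →ₗ[ℂ] Matrix C C ℂ}

/-- The state received when the pair `m` is sent. -/
def received (N : Matrix (A × B) (A × B) ℂ →ₗ[ℂ] Matrix C C ℂ) (m : Fin K₁ × Fin K₂) :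
    Matrix C C ℂ :=
  N (c.enc₁ (Matrix.single m.1 m.1 1) ⊗ₖ c.enc₂ (Matrix.single m.2 m.2 1))

theorem isState_received (hN : IsChannel N) (m : Fin K₁ × Fin K₂) :
    IsState (c.received N m) :=
  hN.isState ((c.enc₁_channel.isState (isState_single _)).kronecker
    (c.enc₂_channel.isState (isState_single _)))

theorem prob_nonneg (hN : IsChannel N) (m m' : Fin K₁ × Fin K₂) : 0 ≤ c.prob N m m' :=
  (Complex.nonneg_iff.mp
    (c.dec_channel.posSemidef (c.isState_received hN m).1).diag_nonneg).1

theorem sum_prob (hN : IsChannel N) (m : Fin K₁ × Fin K₂) : ∑ m', c.prob N m m' = 1 := by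
  have := (c.dec_channel.isState (c.isState_received hN m)).2
  have h2 := congrArg Complex.re this
  rw [trace, Complex.re_sum] at h2
  exact h2

theorem errJoint_eq (hN : IsChannel N) :
    c.errJoint N = (∑ m, (1 - c.prob N m m)) / ((K₁ : ℝ) * (K₂ : ℝ)) := by
  rw [errJoint]
  congr 1
  refine sum_congr rfl fun m _ => ?_
  rw [← c.sum_prob hN m, ← Finset.add_sum_erase _ _ (Finset.mem_univ m), if_neg (by simp), zero_add,
    ← Finset.add_sum_erase Finset.univ (c.prob N m) (Finset.mem_univ m), add_sub_cancel_left]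
  exact sum_congr rfl fun m' hm' => if_pos (Finset.ne_of_mem_erase hm')

theorem err_le_errJoint (hN : IsChannel N) : c.err₁ N ≤ c.errJoint N ∧ c.err₂ N ≤ c.errJoint N := by
  constructor <;>
  · refine div_le_div_of_nonneg_right (sum_le_sum fun m _ => sum_le_sum fun m' _ => ?_)
      (by positivity)
    have := c.prob_nonneg hN m m'
    by_cases h : m' = m
    · simp [h]
    · rw [if_pos h]
      split_ifs <;> simp [this]

theorem errJoint_le_add (hN : IsChannel N) : c.errJoint N ≤ c.err₁ N + c.err₂ N := by
  rw [err₁, err₂, ← add_div, ← sum_add_distrib]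
  simp only [← sum_add_distrib]
  refine div_le_div_of_nonneg_right (sum_le_sum fun m _ => sum_le_sum fun m' _ => ?_)
    (by positivity)
  have := c.prob_nonneg hN m m'
  by_cases h1 : m'.1 = m.1 <;> by_cases h2 : m'.2 = m.2 <;> by_cases h : m' = m <;>
    simp_all [Prod.ext_iff]

theorem err₁_eq (hN : IsChannel N) (hK₁ : 0 < K₁) (hK₂ : 0 < K₂) :
    1 - c.err₁ N = (∑ m, ∑ n, c.prob N m (m.1, n)) / ((K₁ : ℝ) * (K₂ : ℝ)) := by
  have h : ∀ m, (∑ m', if m'.1 ≠ m.1 then c.prob N m m' else 0) =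
      1 - ∑ n, c.prob N m (m.1, n) := by
    intro m
    rw [← c.sum_prob hN m, eq_sub_iff_add_eq]
    have : ∑ n, c.prob N m (m.1, n) = ∑ m', if m'.1 ≠ m.1 then 0 else c.prob N m m' := by
      rw [Fintype.sum_prod_type, Finset.sum_comm]
      exact sum_congr rfl fun n _ => by simp
    rw [this, ← sum_add_distrib]
    exact sum_congr rfl fun m' _ => by split_ifs <;> simp
  have hK : (K₁ : ℝ) * K₂ ≠ 0 := by positivity
  rw [err₁, sum_congr rfl fun m _ => h m, sum_sub_distrib, eq_div_iff hK, sub_mul,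
    div_mul_cancel₀ _ hK]
  simp

theorem err₂_eq (hN : IsChannel N) (hK₁ : 0 < K₁) (hK₂ : 0 < K₂) :
    1 - c.err₂ N = (∑ m, ∑ n, c.prob N m (n, m.2)) / ((K₁ : ℝ) * (K₂ : ℝ)) := by
  have h : ∀ m, (∑ m', if m'.2 ≠ m.2 then c.prob N m m' else 0) =
      1 - ∑ n, c.prob N m (n, m.2) := by
    intro m
    rw [← c.sum_prob hN m, eq_sub_iff_add_eq]
    have : ∑ n, c.prob N m (n, m.2) = ∑ m', if m'.2 ≠ m.2 then 0 else c.prob N m m' := by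
      rw [Fintype.sum_prod_type]
      exact sum_congr rfl fun n _ => by simp
    rw [this, ← sum_add_distrib]
    exact sum_congr rfl fun m' _ => by split_ifs <;> simp
  have hK : (K₁ : ℝ) * K₂ ≠ 0 := by positivity
  rw [err₂, sum_congr rfl fun m _ => h m, sum_sub_distrib, eq_div_iff hK, sub_mul,
    div_mul_cancel₀ _ hK]
  simp

end MACCode

/-! ### Codes from codewords and a measurement -/

section CodeConstruction

variable {A B C U V : Type*} [Fintype A] [Fintype B] [Fintype C] [DecidableEq C]
  {K₁ K₂ : ℕ}

/-- The code with given codewords and a given measurement as decoder. -/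
def codeOf (α : Fin K₁ → Matrix A A ℂ) (β : Fin K₂ → Matrix B B ℂ)
    (Ω : Fin K₁ × Fin K₂ → Matrix C C ℂ) (hα : ∀ m, IsState (α m)) (hβ : ∀ m, IsState (β m))
    (hΩ : ∀ m, (Ω m).PosSemidef) (hΩ1 : ∑ m, Ω m = 1) : MACCode A B C K₁ K₂ where
  enc₁ := measurePrepare (fun m => Matrix.single m m 1) α
  enc₂ := measurePrepare (fun m => Matrix.single m m 1) β
  dec := measurePrepare Ω fun m => Matrix.single m m 1
  enc₁_channel := isChannel_measurePrepare (fun m => (isState_single m).1) sum_single_one hα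
  enc₂_channel := isChannel_measurePrepare (fun m => (isState_single m).1) sum_single_one hβ
  dec_channel := isChannel_measurePrepare hΩ hΩ1 isState_single

theorem measurePrepare_single {X : Type*} (α : Fin K₁ → Matrix X X ℂ) (m : Fin K₁) :
    measurePrepare (fun m => Matrix.single m m 1) α (Matrix.single m m 1) = α m := by
  rw [measurePrepare_apply, Finset.sum_eq_single m]
  · simp
  · intro j _ hj
    simp [single_mul_single_of_ne, hj]
  · simp

theorem prob_codeOf {α : Fin K₁ → Matrix A A ℂ} {β : Fin K₂ → Matrix B B ℂ}
    {Ω : Fin K₁ × Fin K₂ → Matrix C C ℂ} (hα : ∀ m, IsState (α m)) (hβ : ∀ m, IsState (β m))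
    (hΩ : ∀ m, (Ω m).PosSemidef) (hΩ1 : ∑ m, Ω m = 1)
    (N : Matrix (A × B) (A × B) ℂ →ₗ[ℂ] Matrix C C ℂ) (m m' : Fin K₁ × Fin K₂) :
    (codeOf α β Ω hα hβ hΩ hΩ1).prob N m m' = (Ω m' * N (α m.1 ⊗ₖ β m.2)).trace.re := by
  rw [MACCode.prob, codeOf]
  simp only [measurePrepare_single]
  rw [measurePrepare_apply, Matrix.sum_apply, Finset.sum_eq_single m']
  · simp
  · intro j _ hj
    simp [hj]
  · simp

end CodeConstruction

/-! ### Achievability -/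

section Achievability

variable {A B C U V : Type*} [Fintype A] [Fintype B] [Fintype C] [DecidableEq C]
  [Fintype U] [Fintype V] {K₁ K₂ : ℕ}

/-- Random coding: single-user tests for the two senders yield a code with small joint error. -/
theorem exists_code_of_tests {N : Matrix (A × B) (A × B) ℂ →ₗ[ℂ] Matrix C C ℂ} (hN : IsChannel N)
    (hK₁ : 0 < K₁) (hK₂ : 0 < K₂) {p : U → ℝ} {q : V → ℝ} (hp0 : ∀ u, 0 ≤ p u)
    (hq0 : ∀ v, 0 ≤ q v) (hp : ∑ u, p u = 1) (hq : ∑ v, q v = 1)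
    {α : U → Matrix A A ℂ} {β : V → Matrix B B ℂ} (hα : ∀ u, IsState (α u))
    (hβ : ∀ v, IsState (β v)) {Λ : U → Matrix C C ℂ} {Γ : V → Matrix C C ℂ}
    (hΛ0 : ∀ u, (Λ u).PosSemidef) (hΛ1 : ∀ u, (1 - Λ u).PosSemidef)
    (hΓ0 : ∀ v, (Γ v).PosSemidef) (hΓ1 : ∀ v, (1 - Γ v).PosSemidef)
    {ε₁ ε₂ δ₁ δ₂ : ℝ}
    (h1 : 1 - ε₁ ≤ ∑ u, p u * ∑ v, q v * (Λ u * N (α u ⊗ₖ β v)).trace.re)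
    (h2 : ((K₁ : ℝ) - 1) * ∑ u, ∑ u', p u * p u' *
      ∑ v, q v * (Λ u' * N (α u ⊗ₖ β v)).trace.re ≤ δ₁)
    (h3 : 1 - ε₂ ≤ ∑ v, q v * ∑ u, p u * (Γ v * N (α u ⊗ₖ β v)).trace.re)
    (h4 : ((K₂ : ℝ) - 1) * ∑ v, ∑ v', q v * q v' *
      ∑ u, p u * (Γ v' * N (α u ⊗ₖ β v)).trace.re ≤ δ₂) :
    ∃ c : MACCode A B C K₁ K₂, c.errJoint N ≤ 4 * (ε₁ + δ₁ + (ε₂ + δ₂)) := by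
  classical
  set s : U → V → Matrix C C ℂ := fun u v => N (α u ⊗ₖ β v) with hs
  have hsS : ∀ u v, IsState (s u v) := fun u v => hN.isState ((hα u).kronecker (hβ v))
  set f : (Fin K₁ → U) → Fin K₁ → V → ℝ := fun x m v =>
    ∑ j, (if j = m then 1 - (Λ (x j) * s (x m) v).trace.re else (Λ (x j) * s (x m) v).trace.re)
    with hf
  set g : (Fin K₂ → V) → Fin K₂ → U → ℝ := fun y m u =>
    ∑ j, (if j = m then 1 - (Γ (y j) * s u (y m)).trace.re else (Γ (y j) * s u (y m)).trace.re)
    with hg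
  -- J z is the bound on the joint error that the quantum union bound gives for the codebook pair z.
  set J : (Fin K₁ → U) × (Fin K₂ → V) → ℝ := fun z =>
    (∑ m : Fin K₁ × Fin K₂, 4 * (f z.1 m.1 (z.2 m.2) + g z.2 m.2 (z.1 m.1))) /
      ((K₁ : ℝ) * (K₂ : ℝ)) with hJ
  have hKpos : (0 : ℝ) < (K₁ : ℝ) * K₂ := by positivity
  have hF : ∀ m : Fin K₁ × Fin K₂, ∑ x : Fin K₁ → U, ∑ y : Fin K₂ → V,
      codebookProb p x * codebookProb q y * f x m.1 (y m.2) ≤ ε₁ + δ₁ := by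
    intro m
    refine le_trans (le_of_eq ?_) (expected_cost_le hp h1 h2 m.1)
    refine sum_congr rfl fun x _ => ?_
    simp only [mul_assoc, ← Finset.mul_sum]
    congr 1
    -- The first round depends on the second codebook only through the transmitted codeword.
    rw [sum_codebookProb_mul₁ hq m.2 fun v => f x m.1 v]
    simp only [hf, Finset.mul_sum]
    rw [Finset.sum_comm]
    refine sum_congr rfl fun j _ => ?_
    split_ifs
    · simp only [mul_sub, mul_one, sum_sub_distrib, hq, hs]
    · rfl
  have hG : ∀ m : Fin K₁ × Fin K₂, ∑ x : Fin K₁ → U, ∑ y : Fin K₂ → V,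
      codebookProb p x * codebookProb q y * g y m.2 (x m.1) ≤ ε₂ + δ₂ := by
    intro m
    refine le_trans (le_of_eq ?_) (expected_cost_le hq h3 h4 m.2)
    rw [Finset.sum_comm]
    refine sum_congr rfl fun y _ => ?_
    simp only [mul_comm _ (codebookProb q y), mul_assoc, ← Finset.mul_sum]
    congr 1
    rw [sum_codebookProb_mul₁ hp m.1 fun u => g y m.2 u]
    simp only [hg, Finset.mul_sum]
    rw [Finset.sum_comm]
    refine sum_congr rfl fun j _ => ?_
    split_ifs
    · simp only [mul_sub, mul_one, sum_sub_distrib, hp, hs]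
    · rfl
  have hw : ∑ z : (Fin K₁ → U) × (Fin K₂ → V), codebookProb p z.1 * codebookProb q z.2 = 1 := by
    rw [Fintype.sum_prod_type]
    simp only [← Finset.mul_sum, sum_codebookProb hq, mul_one, sum_codebookProb hp]
  have hE : ∑ z : (Fin K₁ → U) × (Fin K₂ → V), codebookProb p z.1 * codebookProb q z.2 * J z ≤
      4 * (ε₁ + δ₁ + (ε₂ + δ₂)) := by
    have e : ∑ z : (Fin K₁ → U) × (Fin K₂ → V), codebookProb p z.1 * codebookProb q z.2 * J z =
        (∑ m : Fin K₁ × Fin K₂, 4 * ((∑ x : Fin K₁ → U, ∑ y : Fin K₂ → V,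
          codebookProb p x * codebookProb q y * f x m.1 (y m.2)) +
          ∑ x : Fin K₁ → U, ∑ y : Fin K₂ → V,
          codebookProb p x * codebookProb q y * g y m.2 (x m.1))) / ((K₁ : ℝ) * (K₂ : ℝ)) := by
      simp only [hJ, mul_div_assoc']
      rw [← Finset.sum_div]
      congr 1
      simp only [Finset.mul_sum]
      rw [Finset.sum_comm]
      refine sum_congr rfl fun m _ => ?_
      rw [Fintype.sum_prod_type, ← sum_add_distrib, Finset.mul_sum]
      refine sum_congr rfl fun x _ => ?_
      rw [← sum_add_distrib, Finset.mul_sum]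
      exact sum_congr rfl fun y _ => by ring
    rw [e, div_le_iff₀ hKpos]
    refine (sum_le_sum fun m _ => mul_le_mul_of_nonneg_left (add_le_add (hF m) (hG m))
      (by norm_num)).trans (le_of_eq ?_)
    simp
    ring
  obtain ⟨⟨x, y⟩, hxy⟩ := exists_le_of_average (fun z => mul_nonneg
    (Finset.prod_nonneg fun i _ => hp0 (z.1 i)) (Finset.prod_nonneg fun i _ => hq0 (z.2 i))) hw hE
  obtain ⟨Ω, hΩ0, hΩ1, hΩ⟩ := exists_measurement hK₁ hK₂ (fun m => Λ (x m)) (fun m => hΛ0 _)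
    (fun m => hΛ1 _) (fun m => Γ (y m)) (fun m => hΓ0 _) (fun m => hΓ1 _)
  refine ⟨codeOf (fun m => α (x m)) (fun m => β (y m)) Ω (fun m => hα _) (fun m => hβ _) hΩ0 hΩ1,
    le_trans ?_ hxy⟩
  rw [MACCode.errJoint_eq _ hN]
  refine div_le_div_of_nonneg_right (sum_le_sum fun m _ => ?_) hKpos.le
  rw [prob_codeOf]
  have h5 := re_trace_mul_nonneg (hΩ m) (hsS (x m.1) (y m.2)).1
  have h6 : (s (x m.1) (y m.2)).trace.re = 1 := by rw [(hsS _ _).2, Complex.one_re]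
  have hite : ∀ {K : ℕ} (L : Fin K → Matrix C C ℂ) (k : Fin K) (S : Matrix C C ℂ),
      S.trace.re = 1 → ((∑ j, if j = k then 1 - L j else L j) * S).trace.re =
        ∑ j, if j = k then 1 - (L j * S).trace.re else (L j * S).trace.re := by
    intro K L k S hS
    rw [Finset.sum_mul, trace_sum, Complex.re_sum]
    refine sum_congr rfl fun j _ => ?_
    split_ifs
    · rw [sub_mul, one_mul, trace_sub, Complex.sub_re, hS]
    · rfl
  rw [sub_mul, trace_sub, Complex.sub_re, sub_mul, one_mul, trace_sub, Complex.sub_re, h6,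
    smul_mul_assoc, trace_smul, add_mul, trace_add, Complex.re_nsmul, nsmul_eq_mul,
    Nat.cast_ofNat, Complex.add_re, hite _ _ _ h6, hite _ _ _ h6] at h5
  linarith

/-- The achievability bound for the multiple-access channel. -/
theorem achievability [DecidableEq U] [DecidableEq V]
    {N : Matrix (A × B) (A × B) ℂ →ₗ[ℂ] Matrix C C ℂ}
    (hN : IsChannel N) {ψ : Matrix (U × A) (U × A) ℂ} {φ : Matrix (V × B) (V × B) ℂ}
    (hψ : IsCQState ψ) (hφ : IsCQState φ) {ε₁ ε₂ δ R₁ R₂ : ℝ} (hδ : 0 < δ)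
    (hK₁ : (K₁ : ℝ) = 2 ^ R₁) (hK₂ : (K₂ : ℝ) = 2 ^ R₂)
    (hR₁ : (R₁ : EReal) ≤ hypoDiv ε₁ (margCU (macOutput N ψ φ))
      (traceSnd (margCU (macOutput N ψ φ)) ⊗ₖ traceFst (margCU (macOutput N ψ φ))) -
      ((Real.logb 2 (1 / δ) : ℝ) : EReal))
    (hR₂ : (R₂ : EReal) ≤ hypoDiv ε₂ (margCV (macOutput N ψ φ))
      (traceSnd (margCV (macOutput N ψ φ)) ⊗ₖ traceFst (margCV (macOutput N ψ φ))) -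
      ((Real.logb 2 (1 / δ) : ℝ) : EReal)) :
    ∃ c : MACCode A B C K₁ K₂, c.errJoint N ≤ 4 * (ε₁ + ε₂ + 2 * δ) := by
  have hpos : ∀ {K : ℕ} {R : ℝ}, (K : ℝ) = 2 ^ R → 0 < K := fun {K R} h => by
    have : (0 : ℝ) < K := h ▸ by positivity
    exact_mod_cast this
  obtain ⟨p, α, hp0, hp, hα, hpα⟩ := hψ.exists_ensemble
  obtain ⟨q, β, hq0, hq, hβ, hqβ⟩ := hφ.exists_ensemble
  have hsS : ∀ u v, IsState (N (α u ⊗ₖ β v)) := fun u v => hN.isState ((hα u).kronecker (hβ v))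
  have hN' : ∀ u v, N (condState ψ u ⊗ₖ condState φ v) =
      ((p u * q v : ℝ) : ℂ) • N (α u ⊗ₖ β v) := by
    intro u v
    rw [hpα, hqβ, smul_kronecker, kronecker_smul, smul_smul, map_smul, Complex.ofReal_mul]
  have htrU : ∀ u, (block (margCU (macOutput N ψ φ)) u).trace = p u := by
    intro u
    rw [block_margCU, trace_sum]
    simp only [hN', trace_smul, (hsS _ _).2, smul_eq_mul, mul_one]
    rw [← Complex.ofReal_sum, ← Finset.mul_sum, hq, mul_one]
  have htrV : ∀ v, (block (margCV (macOutput N ψ φ)) v).trace = q v := by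
    intro v
    rw [block_margCV, trace_sum]
    simp only [hN', trace_smul, (hsS _ _).2, smul_eq_mul, mul_one]
    rw [← Complex.ofReal_sum, ← Finset.sum_mul, hp, one_mul]
  have hLU : ∀ (L : Matrix C C ℂ) u, (L * block (margCU (macOutput N ψ φ)) u).trace.re =
      p u * ∑ v, q v * (L * N (α u ⊗ₖ β v)).trace.re := by
    intro L u
    rw [block_margCU, Finset.mul_sum, trace_sum, Complex.re_sum, Finset.mul_sum]
    refine sum_congr rfl fun v _ => ?_
    rw [hN', Matrix.mul_smul, trace_smul, smul_eq_mul, Complex.re_ofReal_mul, mul_assoc]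
  have hLV : ∀ (L : Matrix C C ℂ) v, (L * block (margCV (macOutput N ψ φ)) v).trace.re =
      q v * ∑ u, p u * (L * N (α u ⊗ₖ β v)).trace.re := by
    intro L v
    rw [block_margCV, Finset.mul_sum, trace_sum, Complex.re_sum, Finset.mul_sum]
    refine sum_congr rfl fun u _ => ?_
    rw [hN', Matrix.mul_smul, trace_smul, smul_eq_mul, Complex.re_ofReal_mul, mul_comm (p u),
      mul_assoc]
  obtain ⟨Λ, hΛ0, hΛ1, hΛ2, hΛ3⟩ :=
    exists_test_of_le_hypoDiv (isBlockDiag_margCU N hψ.2) htrU hδ hK₁ hR₁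
  obtain ⟨Γ, hΓ0, hΓ1, hΓ2, hΓ3⟩ :=
    exists_test_of_le_hypoDiv (isBlockDiag_margCV N hφ.2) htrV hδ hK₂ hR₂
  simp only [Finset.mul_sum (R := Matrix C C ℂ), trace_sum, Complex.re_sum, hLU, hLV]
    at hΛ2 hΛ3 hΓ2 hΓ3
  refine (exists_code_of_tests hN (hpos hK₁) (hpos hK₂) hp0 hq0 hp hq hα hβ hΛ0 hΛ1 hΓ0 hΓ1 hΛ2
    (le_trans (le_of_eq ?_) hΛ3) hΓ2 (le_trans (le_of_eq ?_) hΓ3)).imp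
      fun c hc => hc.trans (le_of_eq (by ring))
  · congr 1
    rw [Finset.sum_comm]
    refine sum_congr rfl fun u _ => ?_
    rw [Finset.mul_sum]
    exact sum_congr rfl fun u' _ => by ring
  · congr 1
    rw [Finset.sum_comm]
    refine sum_congr rfl fun u _ => ?_
    rw [Finset.mul_sum]
    exact sum_congr rfl fun u' _ => by ring

end Achievability

/-! ### Converse -/

section Converse

/-- If n > d, then log n / n ≤ log d / d gives log n ≤ (n/d) log d ≤ (1/s) log d. Since log x / x
decreases only from e on, d = 2 is handled by log 4 / 4 = log 2 / 2, which covers n ≥ 4. The pair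
(2, 3) escapes: for s = 2/3 it would need 3 ≤ 2^(3/2). -/
theorem natCast_le_rpow_or {n d : ℕ} {s : ℝ} (hs : 0 < s) (hs1 : s ≤ 1) (hd : 2 ≤ d)
    (h : (n : ℝ) * s ≤ d) : (n : ℝ) ≤ (d : ℝ) ^ (1 / s) ∨ (d = 2 ∧ n = 3) := by
  have hd0 : (0 : ℝ) < d := by exact_mod_cast (by omega : 0 < d)
  have hd1 : (1 : ℝ) ≤ d := by exact_mod_cast (by omega : 1 ≤ d)
  rcases le_or_gt n d with hnd | hnd
  · left
    exact (Nat.cast_le.mpr hnd).trans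
      (Real.self_le_rpow_of_one_le hd1 ((one_le_div hs).mpr hs1))
  · by_cases hex : d = 2 ∧ n = 3
    · exact Or.inr hex
    left
    have hn0 : (0 : ℝ) < n := by exact_mod_cast (by omega : 0 < n)
    have anti := Real.log_div_self_antitoneOn
    have he : ∀ {k : ℕ}, 3 ≤ k → (k : ℝ) ∈ Set.Ici (Real.exp 1) := fun {k} hk => by
      have h1 : (3 : ℝ) ≤ k := by exact_mod_cast hk
      have h2 := Real.exp_one_lt_d9
      simp only [Set.mem_Ici]
      linarith
    have key : Real.log n / n ≤ Real.log d / d := by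
      rcases Nat.lt_or_ge d 3 with h3 | h3
      · obtain rfl : d = 2 := by omega
        have h4 : 4 ≤ n := by
          by_contra h5
          exact hex ⟨rfl, by omega⟩
        have h6 := anti (he (by norm_num : 3 ≤ 4)) (he (by omega : 3 ≤ n))
          (by exact_mod_cast h4 : ((4 : ℕ) : ℝ) ≤ n)
        refine h6.trans (le_of_eq ?_)
        have : ((4 : ℕ) : ℝ) = 2 ^ 2 := by norm_num
        simp only [this, Real.log_pow]
        push_cast
        ring
      · exact anti (he h3) (he (by omega)) (by exact_mod_cast hnd.le)
    refine Real.le_rpow_of_log_le hd0 ?_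
    rw [div_le_iff₀ hn0] at key
    have h7 : (n : ℝ) / d ≤ 1 / s := by
      rw [div_le_div_iff₀ hd0 hs]
      linarith
    calc Real.log n ≤ Real.log d / d * n := key
      _ = n / d * Real.log d := by ring
      _ ≤ 1 / s * Real.log d := mul_le_mul_of_nonneg_right h7 (Real.log_nonneg hd1)

variable {A B C : Type*} [Fintype A] [Fintype B] [Fintype C] [DecidableEq C]

/-- Tests that succeed on uniformly distributed codewords bound the divergences from below. -/
theorem le_hypoDiv_uniformCQ {N : Matrix (A × B) (A × B) ℂ →ₗ[ℂ] Matrix C C ℂ} (hN : IsChannel N)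
    {u v : ℕ} (hu : 0 < u) (hv : 0 < v)
    {α : Fin u → Matrix A A ℂ} {β : Fin v → Matrix B B ℂ} (hα : ∀ x, IsState (α x))
    (hβ : ∀ y, IsState (β y)) {ε R K : ℝ} (hK : K = 2 ^ R) :
    (∀ Λ : Fin u → Matrix C C ℂ, (∀ x, (Λ x).PosSemidef) → (∀ x, (1 - Λ x).PosSemidef) →
      1 - ε ≤ (∑ x, ∑ y, (Λ x * N (α x ⊗ₖ β y)).trace.re) / ((u : ℝ) * v) →
      (∀ σ, IsState σ → K * ∑ x, (Λ x * σ).trace.re ≤ u) →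
      (R : EReal) ≤ ⨅ σ ∈ {σ : Matrix C C ℂ | IsState σ},
        hypoDiv ε (margCU (macOutput N (uniformCQ α) (uniformCQ β)))
          (σ ⊗ₖ traceFst (margCU (macOutput N (uniformCQ α) (uniformCQ β))))) ∧
    (∀ Γ : Fin v → Matrix C C ℂ, (∀ y, (Γ y).PosSemidef) → (∀ y, (1 - Γ y).PosSemidef) →
      1 - ε ≤ (∑ y, ∑ x, (Γ y * N (α x ⊗ₖ β y)).trace.re) / ((u : ℝ) * v) →
      (∀ σ, IsState σ → K * ∑ y, (Γ y * σ).trace.re ≤ v) →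
      (R : EReal) ≤ ⨅ σ ∈ {σ : Matrix C C ℂ | IsState σ},
        hypoDiv ε (margCV (macOutput N (uniformCQ α) (uniformCQ β)))
          (σ ⊗ₖ traceFst (margCV (macOutput N (uniformCQ α) (uniformCQ β))))) := by
  have hu' : (u : ℝ) ≠ 0 := by positivity
  have hv' : (v : ℝ) ≠ 0 := by positivity
  have hsS : ∀ x y, IsState (N (α x ⊗ₖ β y)) := fun x y => hN.isState ((hα x).kronecker (hβ y))
  have hN' : ∀ x y, N (condState (uniformCQ α) x ⊗ₖ condState (uniformCQ β) y) =
      ((1 / (u * v) : ℝ) : ℂ) • N (α x ⊗ₖ β y) := by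
    intro x y
    rw [condState_uniformCQ, condState_uniformCQ, smul_kronecker, kronecker_smul, smul_smul,
      map_smul]
    push_cast
    rw [one_div_mul_one_div]
  constructor
  · intro Λ h0 h1 h2 h3
    refine le_iInf₂ fun σ hσ => le_hypoDiv (p := fun _ => 1 / (u : ℝ))
      (isBlockDiag_margCU N (isCQState_uniformCQ hu hα).2) h0 h1 (fun x => ?_)
      (fun x => by positivity) (h2.trans (le_of_eq ?_)) hσ.1 hK ?_
    · rw [block_margCU, trace_sum]
      simp only [hN', trace_smul, (hsS _ _).2, smul_eq_mul, mul_one, sum_const, card_univ,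
        Fintype.card_fin, nsmul_eq_mul]
      rw [← Complex.ofReal_natCast, ← Complex.ofReal_mul]
      congr 1
      field_simp
    · rw [Finset.sum_div]
      refine sum_congr rfl fun x _ => ?_
      rw [block_margCU, Finset.mul_sum, trace_sum, Complex.re_sum, Finset.sum_div]
      refine sum_congr rfl fun y _ => ?_
      rw [hN', Matrix.mul_smul, trace_smul, smul_eq_mul, Complex.re_ofReal_mul]
      ring
    · rw [← Finset.mul_sum, mul_left_comm, one_div_mul_eq_div, div_le_one (by positivity)]
      exact h3 σ hσ
  · intro Γ h0 h1 h2 h3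
    refine le_iInf₂ fun σ hσ => le_hypoDiv (p := fun _ => 1 / (v : ℝ))
      (isBlockDiag_margCV N (isCQState_uniformCQ hv hβ).2) h0 h1 (fun y => ?_)
      (fun y => by positivity) (h2.trans (le_of_eq ?_)) hσ.1 hK ?_
    · rw [block_margCV, trace_sum]
      simp only [hN', trace_smul, (hsS _ _).2, smul_eq_mul, mul_one, sum_const, card_univ,
        Fintype.card_fin, nsmul_eq_mul]
      rw [← Complex.ofReal_natCast, ← Complex.ofReal_mul]
      congr 1
      field_simp
    · rw [Finset.sum_div]
      refine sum_congr rfl fun y _ => ?_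
      rw [block_margCV, Finset.mul_sum, trace_sum, Complex.re_sum, Finset.sum_div]
      refine sum_congr rfl fun x _ => ?_
      rw [hN', Matrix.mul_smul, trace_smul, smul_eq_mul, Complex.re_ofReal_mul]
      ring
    · rw [← Finset.mul_sum, mul_left_comm, one_div_mul_eq_div, div_le_one (by positivity)]
      exact h3 σ hσ

omit [Fintype C] in
theorem posSemidef_one_sub_of_sum_eq_one {I : Type*} [Fintype I] {Ω : I → Matrix C C ℂ}
    (h0 : ∀ i, (Ω i).PosSemidef) (h1 : ∑ i, Ω i = 1) (i : I) : (1 - Ω i).PosSemidef := by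
  classical
  rw [← h1, ← Finset.add_sum_erase _ _ (Finset.mem_univ i), add_sub_cancel_left]
  exact posSemidef_sum _ fun j _ => h0 j

/-- Holds because ρ ≤ 1. Summed over a measurement, it bounds the total success by the dimension of
C. -/
theorem re_trace_mul_le_trace {Λ ρ : Matrix C C ℂ} (hΛ : Λ.PosSemidef) (hρ : IsState ρ) :
    (Λ * ρ).trace.re ≤ Λ.trace.re := by
  have := re_trace_mul_nonneg hΛ hρ.one_sub
  rwa [mul_sub, mul_one, trace_sub, Complex.sub_re, sub_nonneg] at this

theorem sum_re_trace_mul {I : Type*} [Fintype I] {Ω : I → Matrix C C ℂ} (h1 : ∑ i, Ω i = 1)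
    {σ : Matrix C C ℂ} (hσ : IsState σ) : ∑ i, (Ω i * σ).trace.re = 1 := by
  rw [← Complex.re_sum, ← trace_sum, ← Finset.sum_mul, h1, one_mul, hσ.2, Complex.one_re]

theorem sum_re_trace {I : Type*} [Fintype I] {Ω : I → Matrix C C ℂ} (h1 : ∑ i, Ω i = 1) :
    ∑ i, (Ω i).trace.re = Fintype.card C := by
  rw [← Complex.re_sum, ← trace_sum, h1, trace_one, Complex.natCast_re]

/-- The trivial test accepts with constant probability. -/
theorem trivial_test {ε : ℝ} (hε : ε ∈ Set.Ioo (0 : ℝ) 1) :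
    (((1 - ε : ℝ) : ℂ) • (1 : Matrix C C ℂ)).PosSemidef ∧
    (1 - ((1 - ε : ℝ) : ℂ) • (1 : Matrix C C ℂ)).PosSemidef ∧
    ∀ σ, IsState σ → ((((1 - ε : ℝ) : ℂ) • (1 : Matrix C C ℂ)) * σ).trace.re = 1 - ε := by
  refine ⟨PosSemidef.one.smul (Complex.zero_le_real.mpr (by linarith [hε.2])), ?_, fun σ hσ => ?_⟩
  · have : 1 - ((1 - ε : ℝ) : ℂ) • (1 : Matrix C C ℂ) = (ε : ℂ) • 1 := by
      push_cast
      rw [sub_smul, one_smul, sub_sub_cancel]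
    rw [this]
    exact PosSemidef.one.smul (Complex.zero_le_real.mpr hε.1.le)
  · rw [smul_mul_assoc, one_mul, trace_smul, hσ.2, smul_eq_mul, mul_one, Complex.ofReal_re]

/-- The converse bound for the multiple-access channel. -/
theorem converse {N : Matrix (A × B) (A × B) ℂ →ₗ[ℂ] Matrix C C ℂ}
    (hN : IsChannel N) {ε₁ ε₂ : ℝ} (hε₁ : ε₁ ∈ Set.Ioo (0 : ℝ) 1) (hε₂ : ε₂ ∈ Set.Ioo (0 : ℝ) 1)
    {R₁ R₂ : ℝ} {K₁ K₂ : ℕ} (c : MACCode A B C K₁ K₂) (hc : c.IsCode N R₁ R₂ ε₁ ε₂) :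
    ∃ (u v : ℕ) (ψ : Matrix (Fin u × A) (Fin u × A) ℂ) (φ : Matrix (Fin v × B) (Fin v × B) ℂ),
      IsCQState ψ ∧ IsCQState φ ∧
      traceSnd ψ = (1 / (u : ℂ)) • (1 : Matrix (Fin u) (Fin u) ℂ) ∧
      traceSnd φ = (1 / (v : ℂ)) • (1 : Matrix (Fin v) (Fin v) ℂ) ∧
      (ε₁ + ε₂ < 1 →
        (u : ℝ) * (v : ℝ) ≤ (Fintype.card C : ℝ) ^ (1 / (1 - ε₁ - ε₂)) ∨
        (Fintype.card C = 2 ∧ K₁ * K₂ = 3 ∧ u * v = 3)) ∧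
      (R₁ : EReal) ≤ ⨅ σ ∈ {σ : Matrix C C ℂ | IsState σ},
        hypoDiv ε₁ (margCU (macOutput N ψ φ)) (σ ⊗ₖ traceFst (margCU (macOutput N ψ φ))) ∧
      (R₂ : EReal) ≤ ⨅ τ ∈ {τ : Matrix C C ℂ | IsState τ},
        hypoDiv ε₂ (margCV (macOutput N ψ φ)) (τ ⊗ₖ traceFst (margCV (macOutput N ψ φ))) := by
  obtain ⟨hR₁, hR₂, he₁, he₂⟩ := hc
  have hpos : ∀ {K : ℕ} {R : ℝ}, (K : ℝ) = 2 ^ R → 0 < K := fun {K R} h => by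
    have : (0 : ℝ) < K := h ▸ by positivity
    exact_mod_cast this
  have hK₁ := hpos hR₁
  have hK₂ := hpos hR₂
  have hK : (0 : ℝ) < (K₁ : ℝ) * K₂ := by positivity
  obtain ⟨Ω, hΩ0, hΩ1, hΩ⟩ := c.dec_channel.exists_measurement
  have hprob : ∀ m m', c.prob N m m' = (Ω m' * c.received N m).trace.re := fun m m' => by
    rw [MACCode.prob, hΩ, MACCode.received]
  have hs := c.isState_received hN
  set Λ : Fin K₁ → Matrix C C ℂ := fun m => ∑ n, Ω (m, n) with hΛ
  set Γ : Fin K₂ → Matrix C C ℂ := fun n => ∑ m, Ω (m, n) with hΓ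
  have hΛ0 : ∀ m, (Λ m).PosSemidef := fun m => posSemidef_sum _ fun n _ => hΩ0 _
  have hΓ0 : ∀ n, (Γ n).PosSemidef := fun n => posSemidef_sum _ fun m _ => hΩ0 _
  have hΛ1 : ∑ m, Λ m = 1 := by rw [← hΩ1, Fintype.sum_prod_type]
  have hΓ1 : ∑ n, Γ n = 1 := by rw [← hΩ1, Fintype.sum_prod_type_right]
  have hs₁ : 1 - ε₁ ≤ (∑ x, ∑ y, (Λ x * c.received N (x, y)).trace.re) / ((K₁ : ℝ) * K₂) := by
    refine le_trans (sub_le_sub_left he₁ 1) (le_of_eq ?_)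
    rw [c.err₁_eq hN hK₁ hK₂, Fintype.sum_prod_type]
    simp only [hprob, hΛ, Finset.sum_mul, trace_sum, Complex.re_sum]
  have hs₂ : 1 - ε₂ ≤ (∑ y, ∑ x, (Γ y * c.received N (x, y)).trace.re) / ((K₁ : ℝ) * K₂) := by
    refine le_trans (sub_le_sub_left he₂ 1) (le_of_eq ?_)
    rw [c.err₂_eq hN hK₁ hK₂, Fintype.sum_prod_type_right]
    simp only [hprob, hΓ, Finset.sum_mul, trace_sum, Complex.re_sum]
  have hα : ∀ m, IsState (c.enc₁ (Matrix.single m m 1)) := fun m =>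
    c.enc₁_channel.isState (isState_single m)
  have hβ : ∀ m, IsState (c.enc₂ (Matrix.single m m 1)) := fun m =>
    c.enc₂_channel.isState (isState_single m)
  have hC : 0 < Fintype.card C :=
    Fintype.card_pos_iff.mpr (hs (⟨0, hK₁⟩, ⟨0, hK₂⟩)).nonempty
  rcases Nat.lt_or_ge (Fintype.card C) 2 with hd | hd
  -- Here the size bound requires |U||V| ≤ 1, although the code may have several messages. They can
  -- only be guessed, so K(1 - ε) ≤ 1, and the test (1 - ε)·1 on one-valued registers already
  -- witnesses R = log K.
  · have hd1 : (Fintype.card C : ℝ) = 1 := by exact_mod_cast (by omega : Fintype.card C = 1)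
    have hb₁ : (K₁ : ℝ) * (1 - ε₁) ≤ 1 := by
      have h : ∑ x, ∑ y, (Λ x * c.received N (x, y)).trace.re ≤ K₂ := by
        refine (sum_le_sum fun x _ => sum_le_sum fun y _ =>
          re_trace_mul_le_trace (hΛ0 x) (hs (x, y))).trans (le_of_eq ?_)
        simp [← Finset.mul_sum, sum_re_trace hΛ1, hd1]
      rw [le_div_iff₀ hK] at hs₁
      have hK₂' : (0 : ℝ) < K₂ := by positivity
      nlinarith
    have hb₂ : (K₂ : ℝ) * (1 - ε₂) ≤ 1 := by
      have h : ∑ y, ∑ x, (Γ y * c.received N (x, y)).trace.re ≤ K₁ := by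
        refine (sum_le_sum fun y _ => sum_le_sum fun x _ =>
          re_trace_mul_le_trace (hΓ0 y) (hs (x, y))).trans (le_of_eq ?_)
        simp [← Finset.mul_sum, sum_re_trace hΓ1, hd1]
      rw [le_div_iff₀ hK] at hs₂
      have hK₁' : (0 : ℝ) < K₁ := by positivity
      nlinarith
    obtain ⟨t0, t1, t2⟩ := trivial_test (C := C) hε₁
    obtain ⟨r0, r1, r2⟩ := trivial_test (C := C) hε₂
    have hα' := fun _ : Fin 1 => hα ⟨0, hK₁⟩
    have hβ' := fun _ : Fin 1 => hβ ⟨0, hK₂⟩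
    have hsS := fun x y : Fin 1 => hN.isState ((hα' x).kronecker (hβ' y))
    refine ⟨1, 1, uniformCQ fun _ => c.enc₁ (Matrix.single ⟨0, hK₁⟩ ⟨0, hK₁⟩ 1),
      uniformCQ fun _ => c.enc₂ (Matrix.single ⟨0, hK₂⟩ ⟨0, hK₂⟩ 1),
      isCQState_uniformCQ one_pos hα', isCQState_uniformCQ one_pos hβ', traceSnd_uniformCQ hα',
      traceSnd_uniformCQ hβ', fun _ => Or.inl (by simp [hd1]), ?_, ?_⟩
    · refine (le_hypoDiv_uniformCQ hN one_pos one_pos hα' hβ' hR₁).1 (fun _ => _) (fun _ => t0)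
        (fun _ => t1) (le_of_eq ?_) fun σ hσ => ?_
      · simp only [t2 _ (hsS 0 0)]
        simp
      · simp only [t2 _ hσ]
        simpa using hb₁
    · refine (le_hypoDiv_uniformCQ hN one_pos one_pos hα' hβ' hR₂).2 (fun _ => _) (fun _ => r0)
        (fun _ => r1) (le_of_eq ?_) fun σ hσ => ?_
      · simp only [r2 _ (hsS 0 0)]
        simp
      · simp only [r2 _ hσ]
        simpa using hb₂
  · refine ⟨K₁, K₂, uniformCQ fun m => c.enc₁ (Matrix.single m m 1),
      uniformCQ fun m => c.enc₂ (Matrix.single m m 1),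
      isCQState_uniformCQ hK₁ hα, isCQState_uniformCQ hK₂ hβ, traceSnd_uniformCQ hα,
      traceSnd_uniformCQ hβ, fun hε => ?_, ?_, ?_⟩
    -- The pair is decoded correctly with probability at least 1 - ε₁ - ε₂, while the success
    -- probabilities of all pairs sum to at most Tr 1 = |C|.
    · have hj : ((K₁ * K₂ : ℕ) : ℝ) * (1 - ε₁ - ε₂) ≤ Fintype.card C := by
        have h1 := (c.errJoint_le_add hN).trans (add_le_add he₁ he₂)
        rw [c.errJoint_eq hN, div_le_iff₀ hK, sum_sub_distrib] at h1
        have h2 : ∑ m, c.prob N m m ≤ Fintype.card C := by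
          rw [← sum_re_trace hΩ1]
          exact sum_le_sum fun m _ => hprob m m ▸ re_trace_mul_le_trace (hΩ0 m) (hs m)
        simp only [sum_const, card_univ, Fintype.card_prod, Fintype.card_fin, nsmul_eq_mul,
          mul_one] at h1
        push_cast at h1 ⊢
        linarith
      rcases natCast_le_rpow_or (by linarith) (by linarith [hε₁.1, hε₂.1]) hd hj with h | h
      · left
        rwa [Nat.cast_mul] at h
      · exact Or.inr ⟨h.1, h.2, h.2⟩
    · refine (le_hypoDiv_uniformCQ hN hK₁ hK₂ hα hβ hR₁).1 Λ hΛ0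
        (posSemidef_one_sub_of_sum_eq_one hΛ0 hΛ1) hs₁ fun σ hσ => ?_
      rw [sum_re_trace_mul hΛ1 hσ, mul_one]
    · refine (le_hypoDiv_uniformCQ hN hK₁ hK₂ hα hβ hR₂).2 Γ hΓ0
        (posSemidef_one_sub_of_sum_eq_one hΓ0 hΓ1) hs₂ fun σ hσ => ?_
      rw [sum_re_trace_mul hΓ1 hσ, mul_one]

end Converse

end

end QMAC

theorem theorem14 {A B C : Type*} [Fintype A] [DecidableEq A] [Fintype B] [DecidableEq B]
    [Fintype C] [DecidableEq C]
    (N : Matrix (A × B) (A × B) ℂ →ₗ[ℂ] Matrix C C ℂ) (hN : QMAC.IsChannel N)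
    (ε₁ ε₂ : ℝ) (hε₁ : ε₁ ∈ Set.Ioo (0 : ℝ) 1) (hε₂ : ε₂ ∈ Set.Ioo (0 : ℝ) 1) :
    -- converse
    (∀ (R₁ R₂ : ℝ) (K₁ K₂ : ℕ) (c : QMAC.MACCode A B C K₁ K₂), c.IsCode N R₁ R₂ ε₁ ε₂ →
      ∃ (u v : ℕ) (ψ : Matrix (Fin u × A) (Fin u × A) ℂ) (φ : Matrix (Fin v × B) (Fin v × B) ℂ),
        QMAC.IsCQState ψ ∧ QMAC.IsCQState φ ∧
        QMAC.traceSnd ψ = (1 / (u : ℂ)) • (1 : Matrix (Fin u) (Fin u) ℂ) ∧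
        QMAC.traceSnd φ = (1 / (v : ℂ)) • (1 : Matrix (Fin v) (Fin v) ℂ) ∧
        (ε₁ + ε₂ < 1 →
          (u : ℝ) * (v : ℝ) ≤ (Fintype.card C : ℝ) ^ (1 / (1 - ε₁ - ε₂)) ∨
          (Fintype.card C = 2 ∧ K₁ * K₂ = 3 ∧ u * v = 3)) ∧
        (R₁ : EReal) ≤ ⨅ σ ∈ {σ : Matrix C C ℂ | QMAC.IsState σ},
          QMAC.hypoDiv ε₁ (QMAC.margCU (QMAC.macOutput N ψ φ))
            (σ ⊗ₖ
              (QMAC.traceFst (QMAC.margCU (QMAC.macOutput N ψ φ)))) ∧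
        (R₂ : EReal) ≤ ⨅ τ ∈ {τ : Matrix C C ℂ | QMAC.IsState τ},
          QMAC.hypoDiv ε₂ (QMAC.margCV (QMAC.macOutput N ψ φ))
            (τ ⊗ₖ
              (QMAC.traceFst (QMAC.margCV (QMAC.macOutput N ψ φ))))) ∧
    -- achievability
    (∀ (U V : Type*) [Fintype U] [DecidableEq U] [Fintype V] [DecidableEq V]
      (ψ : Matrix (U × A) (U × A) ℂ) (φ : Matrix (V × B) (V × B) ℂ),
      QMAC.IsCQState ψ → QMAC.IsCQState φ →
      ∀ δ ∈ Set.Ioo (0 : ℝ) 1, ∀ (R₁ R₂ : ℝ) (K₁ K₂ : ℕ),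
        (K₁ : ℝ) = 2 ^ R₁ → (K₂ : ℝ) = 2 ^ R₂ →
        (R₁ : EReal) ≤ QMAC.hypoDiv ε₁ (QMAC.margCU (QMAC.macOutput N ψ φ))
            ((QMAC.traceSnd (QMAC.margCU (QMAC.macOutput N ψ φ))) ⊗ₖ
              (QMAC.traceFst (QMAC.margCU (QMAC.macOutput N ψ φ))))
            - ((Real.logb 2 (1 / δ) : ℝ) : EReal) →
        (R₂ : EReal) ≤ QMAC.hypoDiv ε₂ (QMAC.margCV (QMAC.macOutput N ψ φ))
            ((QMAC.traceSnd (QMAC.margCV (QMAC.macOutput N ψ φ))) ⊗ₖ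
              (QMAC.traceFst (QMAC.margCV (QMAC.macOutput N ψ φ))))
            - ((Real.logb 2 (1 / δ) : ℝ) : EReal) →
        ∃ c : QMAC.MACCode A B C K₁ K₂,
          c.IsCode N R₁ R₂ (4 * (ε₁ + ε₂ + 2 * δ)) (4 * (ε₁ + ε₂ + 2 * δ)) ∧
          c.errJoint N ≤ 4 * (ε₁ + ε₂ + 2 * δ)) :=
  ⟨fun _ _ _ _ c hc => QMAC.converse hN hε₁ hε₂ c hc,
    fun _ _ _ _ _ _ _ _ hψ hφ _ hδ _ _ _ _ hK₁ hK₂ hR₁ hR₂ =>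
      (QMAC.achievability hN hψ hφ hδ.1 hK₁ hK₂ hR₁ hR₂).imp fun c hc =>
        ⟨⟨hK₁, hK₂, (c.err_le_errJoint hN).1.trans hc, (c.err_le_errJoint hN).2.trans hc⟩, hc⟩⟩
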